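/- Let $R$ be a commutative ring and let $\mathcal P$ be a symmetric operad in $R$-modules, i.e. a sequence $(\mathcal P(n))_{n\in\mathbb N}$ of $R$-modules with a unit $1_{\mathcal P}\in\mathcal P(1)$, right actions of the symmetric groups $\Sigma(n)$, and $R$-bilinear partial compositions $\circ_i:\mathcal P(m)\times\mathcal P(n)\to\mathcal P(m+n-1)$ ($1\le i\le m$) satisfying the usual unit, equivariance, sequential and parallel associativity axioms. For $\mu\in\mathcal P(k)$ and $\nu_j\in\mathcal P(n_j)$ put $\mu(\nu_1,\dots,\nu_k)=(\cdots((\mu\circ_k\nu_k)\circ_{k-1}\nu_{k-1})\cdots)\circ_1\nu_1$. For an $R$-module $V$ let $$\mathsf S(\mathcal P,V)=\bigoplus_{n\in\mathbb N}\bigl(\mathcal P(n)\otimes V^{\otimes n}\bigr)_{\Sigma(n)},$$ and let $(\mu;v_1,\dots,v_n)$ denote the class of $\mu\otimes v_1\otimes\cdots\otimes v_n$. This is a functor in $V$ via $\mathsf S(\mathcal P,f)(\mu;v_1,\dots,v_n)=(\mu;f(v_1),\dots,f(v_n))$. The associated monad $(\mathsf S(\mathcal P,-),\gamma,\eta)$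 on the category of $R$-modules, given by $\eta_V(v)=(1_{\mathcal P};v)$ and $$\gamma_V\bigl(\mu;(\nu_1;v_{1,1},\dots,v_{1,n_1}),\dots,(\nu_k;v_{k,1},\dots,v_{k,n_k})\bigr)=\bigl(\mu(\nu_1,\dots,\nu_k);v_{1,1},\dots,v_{k,n_k}\bigr),$$ exists, and there are $R$-linear maps $\partial_V:\mathsf S(\mathcal P,V)\to\mathsf S(\mathcal P,V\times V)$ with $$\partial_V(\mu;v_1,\dots,v_n)=\sum_{i=1}^n\bigl(\mu;(v_1,0),\dots,(0,v_i),\dots,(v_n,0)\bigr),$$ which form a differential combinator transformation, so that $(\mathsf S(\mathcal P,-),\gamma,\eta,\partial)$ is a coCartesian differential monad. That is, writing $\mathsf S=\mathsf S(\mathcal P,-)$, with $\pi_j$ the projections of $V\times V$ or of $V\times V\times V\times V$, the maps $\partial_V$ are natural in $V$ and satisfy: 1. $\mathsf S(\pi_1)\circ\partial_V=0$; 2. $\mathsf S(\langle\pi_1,\pi_2,\pi_2\rangle)\circ\partial_V=\mathsf S(\langle\pi_1,\pi_2,0\rangle)\circ\partial_V+\mathsf S(\langle\pi_1,0,\pi_2\rangle)\circ\partial_V$;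 3. $\partial_V\circ\eta_V=\eta_{V\times V}\circ\langle 0,1_V\rangle$; 4. $\partial_V\circ\gamma_V=\gamma_{V\times V}\circ\mathsf S\bigl(\mathsf S(\langle 1_V,0\rangle)\circ\pi_1+\partial_V\circ\pi_2\bigr)\circ\partial_{\mathsf S(V)}$; 5. $\mathsf S(\langle\pi_1,\pi_4\rangle)\circ\partial_{V\times V}\circ\partial_V=\partial_V$; 6. $\mathsf S(\langle\pi_1,\pi_3,\pi_2,\pi_4\rangle)\circ\partial_{V\times V}\circ\partial_V=\partial_{V\times V}\circ\partial_V$. Consequently the opposite of the Kleisli category of this monad is a Cartesian differential category. Here a map $V\to W$ in this category is an $R$-linear map $f:W\to\mathsf S(\mathcal P,V)$; maps are added pointwise; the product of $V$ and $W$ is $V\times W$, with projections $\eta\circ\iota_1$ and $\eta\circ\iota_2$, where $\iota_1,\iota_2$ are the injections into $V\times W$; and the differential combinator is $\mathsf D[f]=\partial_V\circ f$. -/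

import Mathlib

open CategoryTheory Limits

universe u v w

/-! ### Positions of inputs in a partial composition

Inputs of an operation of arity `m` are numbered by `Fin m`, so counting starts at `0`. When an
operation with `n` inputs is plugged into input `i` of an operation with `m` inputs, the result has
`p = m + n - 1` inputs: the inputs before `i` keep their place, the `n` new ones take the places
`i, …, i + n - 1`, and the inputs after `i` are shifted. The arity `p` is carried along with a proof
of `p + 1 = m + n`, which determines it. -/

/-- The place, in the composite, of an input of the outer operation (other than `i`) or of the
inner operation. -/
def Operad.blockFun {m n p : ℕ} (i : Fin m) (h : p + 1 = m + n) :
    {j : Fin m // j ≠ i} ⊕ Fin n → Fin p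
  | .inl j =>
      if hlt : j.1 < i then ⟨j.1, by have := i.2; omega⟩
      else ⟨j.1 + n - 1, by
        have := i.2; have := j.1.2; have := Fin.val_ne_of_ne j.2
        rw [Fin.lt_def] at hlt; omega⟩
  | .inr k => ⟨i + k, by have := i.2; have := k.2; omega⟩

theorem Operad.blockFun_bijective {m n p : ℕ} (i : Fin m) (h : p + 1 = m + n) :
    Function.Bijective (Operad.blockFun i h) := by
  rw [Fintype.bijective_iff_injective_and_card]
  constructor
  · rintro (⟨a, ha⟩ | a) (⟨b, hb⟩ | b) hab
    · have := Fin.val_ne_of_ne ha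
      have := Fin.val_ne_of_ne hb
      simp only [Operad.blockFun, Fin.lt_def] at hab
      congr 2
      apply Fin.ext
      split_ifs at hab <;> simp only [Fin.mk.injEq] at hab <;> omega
    · have := Fin.val_ne_of_ne ha
      have := b.2
      simp only [Operad.blockFun, Fin.lt_def] at hab
      split_ifs at hab <;> simp only [Fin.mk.injEq] at hab <;> omega
    · have := Fin.val_ne_of_ne hb
      have := a.2
      simp only [Operad.blockFun, Fin.lt_def] at hab
      split_ifs at hab <;> simp only [Fin.mk.injEq] at hab <;> omega
    · simp only [Operad.blockFun, Fin.mk.injEq] at hab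
      congr 1
      apply Fin.ext
      omega
  · have := i.2
    simp
    omega

/-- The bijection from the inputs of the outer operation other than `i`, together with the inputs of
the inner operation, onto the inputs of the composite. -/
noncomputable def Operad.block {m n p : ℕ} (i : Fin m) (h : p + 1 = m + n) :
    {j : Fin m // j ≠ i} ⊕ Fin n ≃ Fin p :=
  Equiv.ofBijective (Operad.blockFun i h) (Operad.blockFun_bijective i h)

/-- The permutation of the inputs of the composite that permutes the inputs of the inner operation
by `σ` and fixes those of the outer one. -/
noncomputable def Operad.innerPerm {m n p : ℕ} (i : Fin m) (h : p + 1 = m + n)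
    (σ : Equiv.Perm (Fin n)) : Equiv.Perm (Fin p) :=
  (Operad.block i h).symm.trans
    ((Equiv.sumCongr (Equiv.refl _) σ).trans (Operad.block i h))

/-- The permutation of the inputs of the composite induced by a permutation `σ` of the inputs of the
outer operation, which moves the inputs of the inner operation, as a block, from input `i` to input
`σ i`. -/
noncomputable def Operad.outerPerm {m n p : ℕ} (i : Fin m) (h : p + 1 = m + n)
    (σ : Equiv.Perm (Fin m)) : Equiv.Perm (Fin p) :=
  (Operad.block i h).symm.trans
    ((Equiv.sumCongr (σ.subtypeEquiv (fun _ => (EmbeddingLike.apply_eq_iff_eq σ).not.symm))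
      (Equiv.refl _)).trans (Operad.block (σ i) h))

/-! ### Operads -/

/-- A symmetric operad in `R`-modules, given by partial compositions. -/
structure Operad (R : Type u) [CommRing R] where
  /-- the module of operations of arity `n` -/
  obj : ℕ → Type u
  [addCommGroup : ∀ n, AddCommGroup (obj n)]
  [module : ∀ n, Module R (obj n)]
  /-- the distinguished operation of arity one -/
  one : obj 1
  /-- the right action of the symmetric group: `act σ μ` is `μ · σ` -/
  act : ∀ {n : ℕ}, Equiv.Perm (Fin n) → obj n →ₗ[R] obj n
  act_one : ∀ {n : ℕ} (μ : obj n), act 1 μ = μ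
  act_mul : ∀ {n : ℕ} (σ τ : Equiv.Perm (Fin n)) (μ : obj n), act (σ * τ) μ = act τ (act σ μ)
  /-- the partial compositions: `circ i h μ ν` is `μ ∘ᵢ ν`, of arity `p = m + n - 1` -/
  circ : ∀ {m n p : ℕ} (_ : Fin m) (_ : p + 1 = m + n), obj m →ₗ[R] obj n →ₗ[R] obj p
  one_circ : ∀ {n : ℕ} (h : n + 1 = 1 + n) (ν : obj n), circ 0 h one ν = ν
  circ_one : ∀ {m : ℕ} (i : Fin m) (h : m + 1 = m + 1) (μ : obj m), circ i h μ one = μ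
  /-- equivariance in the inner operation -/
  circ_act : ∀ {m n p : ℕ} (i : Fin m) (h : p + 1 = m + n) (μ : obj m)
    (σ : Equiv.Perm (Fin n)) (ν : obj n),
    circ i h μ (act σ ν) = act (Operad.innerPerm i h σ) (circ i h μ ν)
  /-- equivariance in the outer operation -/
  act_circ : ∀ {m n p : ℕ} (i : Fin m) (h : p + 1 = m + n) (σ : Equiv.Perm (Fin m)) (μ : obj m)
    (ν : obj n),
    circ i h (act σ μ) ν = act (Operad.outerPerm i h σ) (circ (σ i) h μ ν)
  /-- sequential composition -/
  circ_assoc : ∀ {l m n p q r : ℕ} (i : Fin l) (j : Fin m)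
    (hp : p + 1 = l + m) (hq : q + 1 = p + n) (hr : r + 1 = m + n) (hq' : q + 1 = l + r)
    (lam : obj l) (μ : obj m) (ν : obj n),
    circ (⟨i + j, by have := i.2; have := j.2; omega⟩ : Fin p) hq (circ i hp lam μ) ν
      = circ i hq' lam (circ j hr μ ν)
  /-- parallel composition -/
  circ_comm : ∀ {l m n p q r : ℕ} (i k : Fin l) (hik : i < k)
    (hp : p + 1 = l + m) (hq : q + 1 = p + n) (hr : r + 1 = l + n) (hq' : q + 1 = r + m)
    (lam : obj l) (μ : obj m) (ν : obj n),
    circ (⟨k + m - 1, by have := k.2; rw [Fin.lt_def] at hik; omega⟩ : Fin p) hq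
        (circ i hp lam μ) ν
      = circ (⟨i, by have := k.2; rw [Fin.lt_def] at hik; omega⟩ : Fin r) hq'
        (circ k hr lam ν) μ

attribute [instance] Operad.addCommGroup Operad.module

namespace Operad

section

open scoped TensorProduct

variable {R : Type u} [CommRing R] (P : Operad R)

/-- Auxiliary to the complete composition: plug `ν j` into the inputs `j = k - 1, …, 0` of `μ`,
the last one first, leaving the inputs of `μ` from `k` on as they are. -/
def compAux : ∀ (k : ℕ) {p q : ℕ} (n : Fin k → ℕ), k ≤ p → q + k = p + ∑ j, n j →
    P.obj p → (∀ j, P.obj (n j)) → P.obj q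
  | 0, p, q, _, _, h, μ, _ =>
      cast (congrArg P.obj (show p = q by simp at h; omega)) μ
  | k + 1, p, q, n, hk, h, μ, ν =>
      compAux k (p := p + n (Fin.last k) - 1) (fun j => n j.castSucc) (by omega)
        (by rw [Fin.sum_univ_castSucc] at h; omega)
        (P.circ (⟨k, by omega⟩ : Fin p) (by omega) μ (ν (Fin.last k))) (fun j => ν j.castSucc)

/-- The complete composition
`μ(ν₁, …, νₖ) = (⋯((μ ∘ₖ νₖ) ∘ₖ₋₁ νₖ₋₁)⋯) ∘₁ ν₁`, of arity `n₁ + ⋯ + nₖ`. -/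
def comp {k : ℕ} {n : Fin k → ℕ} (μ : P.obj k) (ν : ∀ j, P.obj (n j)) : P.obj (∑ j, n j) :=
  P.compAux k n le_rfl (by omega) μ ν

/-! ### The Schur functor of an operad -/

/-- The left action of the symmetric group on `P(n)` obtained from the right one. -/
def rep (n : ℕ) : Representation R (Equiv.Perm (Fin n)) (P.obj n) where
  toFun σ := P.act σ⁻¹
  map_one' := by ext μ; simp [P.act_one]
  map_mul' σ τ := by ext μ; simp [P.act_mul]

/-- The action of the symmetric group on `V^{⊗ n}` that permutes the factors. -/
noncomputable def permRep (R : Type u) [CommRing R] (n : ℕ) (V : Type u) [AddCommGroup V]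
    [Module R V] : Representation R (Equiv.Perm (Fin n)) (⨂[R] _ : Fin n, V) where
  toFun σ := (PiTensorProduct.reindex R (fun _ : Fin n => V) σ).toLinearMap
  map_one' := by
    apply PiTensorProduct.ext
    ext v
    simp only [LinearMap.compMultilinearMap_apply, LinearEquiv.coe_coe, Module.End.one_apply,
      PiTensorProduct.reindex_tprod]
    rfl
  map_mul' σ τ := by
    apply PiTensorProduct.ext
    ext v
    simp only [LinearMap.compMultilinearMap_apply, LinearEquiv.coe_coe, Module.End.mul_apply,
      PiTensorProduct.reindex_tprod]
    rfl

/-- The diagonal action of the symmetric group on `P(n) ⊗ V^{⊗ n}`. -/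
noncomputable abbrev diagRep (n : ℕ) (V : Type u) [AddCommGroup V] [Module R V] :
    Representation R (Equiv.Perm (Fin n)) (P.obj n ⊗[R] (⨂[R] _ : Fin n, V)) :=
  (P.rep n).tprod (permRep R n V)

/-- `S(P, V)`, the direct sum over `n` of the coinvariants of `P(n) ⊗ V^{⊗ n}`. -/
abbrev Schur (V : Type u) [AddCommGroup V] [Module R V] : Type u :=
  DirectSum ℕ fun n => (P.diagRep n V).Coinvariants

/-- The element `(μ; v₁, …, vₙ)` of `S(P, V)`. -/
noncomputable def elt {V : Type u} [AddCommGroup V] [Module R V] {n : ℕ} (μ : P.obj n)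
    (v : Fin n → V) : P.Schur V :=
  DirectSum.lof R ℕ (fun n => (P.diagRep n V).Coinvariants) n
    (Representation.Coinvariants.mk (P.diagRep n V) (μ ⊗ₜ[R] PiTensorProduct.tprod R v))

/-- The linear map `S(P, f)`, with `S(P, f)(μ; v₁, …, vₙ) = (μ; f v₁, …, f vₙ)`. -/
noncomputable def schurMap {V W : Type u} [AddCommGroup V] [Module R V] [AddCommGroup W]
    [Module R W] (f : V →ₗ[R] W) : P.Schur V →ₗ[R] P.Schur W :=
  DirectSum.toModule R ℕ _ fun n =>
    Representation.Coinvariants.lift (P.diagRep n V)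
      (DirectSum.lof R ℕ (fun n => (P.diagRep n W).Coinvariants) n ∘ₗ
        Representation.Coinvariants.mk (P.diagRep n W) ∘ₗ
          TensorProduct.map LinearMap.id (PiTensorProduct.map fun _ => f))
      (by
        intro σ
        apply TensorProduct.ext'
        intro μ x
        have key : ∀ x : ⨂[R] _ : Fin n, V,
            PiTensorProduct.map (fun _ => f) (permRep R n V σ x)
              = permRep R n W σ (PiTensorProduct.map (fun _ => f) x) := fun x =>
          PiTensorProduct.map_reindex (fun _ : Fin n => f) σ x
        have h := Representation.Coinvariants.mk_self_apply (P.diagRep n W) σ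
          (μ ⊗ₜ[R] PiTensorProduct.map (fun _ => f) x)
        simp only [LinearMap.comp_apply, Representation.tprod_apply, TensorProduct.map_tmul,
          LinearMap.id_apply, key] at h ⊢
        rw [h])

theorem schurMap_elt {V W : Type u} [AddCommGroup V] [Module R V] [AddCommGroup W]
    [Module R W] (f : V →ₗ[R] W) {n : ℕ} (μ : P.obj n) (v : Fin n → V) :
    P.schurMap f (P.elt μ v) = P.elt μ (fun i => f (v i)) := by
  simp [schurMap, elt, DirectSum.toModule_lof, PiTensorProduct.map_tprod]

/-- Linear maps on `S(P, V)` are determined by their values on the elements `(μ; v₁, …, vₙ)`. -/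
theorem schur_hom_ext {V W : Type u} [AddCommGroup V] [Module R V] [AddCommGroup W]
    [Module R W] {f g : P.Schur V →ₗ[R] W}
    (h : ∀ (n : ℕ) (μ : P.obj n) (v : Fin n → V), f (P.elt μ v) = g (P.elt μ v)) : f = g := by
  refine DirectSum.linearMap_ext R fun n => ?_
  apply Representation.Coinvariants.hom_ext
  apply TensorProduct.ext
  ext μ v
  exact h n μ v

/-- The functor `S(P, -)` on `R`-modules. -/
noncomputable def schurFunctor : ModuleCat.{u} R ⥤ ModuleCat.{u} R where
  obj V := ModuleCat.of R (P.Schur V)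
  map f := ModuleCat.ofHom (P.schurMap f.hom)
  map_id V := by
    apply ModuleCat.hom_ext
    apply P.schur_hom_ext
    intro n μ v
    simp [schurMap_elt]
  map_comp f g := by
    apply ModuleCat.hom_ext
    apply P.schur_hom_ext
    intro n μ v
    simp [schurMap_elt]

/-- The monad `(S(P, -), γ, η)` associated to `P`: the functor is `S(P, -)`, and `η` and `γ` are
given by
`η v = (1; v)` and
`γ (μ; (ν₁; v₁₁, …), …, (νₖ; vₖ₁, …)) = (μ(ν₁, …, νₖ); v₁₁, …, vₖₙₖ)`,
which determines them by `schur_hom_ext` and multilinearity. -/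
structure AssociatedMonad where
  /-- the unit -/
  η : 𝟭 (ModuleCat.{u} R) ⟶ P.schurFunctor
  /-- the multiplication -/
  γ : P.schurFunctor ⋙ P.schurFunctor ⟶ P.schurFunctor
  η_apply : ∀ (V : ModuleCat.{u} R) (v : V),
    (η.app V).hom v = P.elt P.one (fun _ => v)
  γ_apply : ∀ (V : ModuleCat.{u} R) {k : ℕ} {n : Fin k → ℕ} (μ : P.obj k)
    (ν : ∀ j, P.obj (n j)) (v : ∀ j, Fin (n j) → V),
    (γ.app V).hom (P.elt μ fun j => P.elt (ν j) (v j)) =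
      P.elt (P.comp μ ν) fun i => v (finSigmaFinEquiv.symm i).1 (finSigmaFinEquiv.symm i).2
  assoc : ∀ V, P.schurFunctor.map (γ.app V) ≫ γ.app V = γ.app (P.schurFunctor.obj V) ≫ γ.app V
  left_unit : ∀ V, η.app (P.schurFunctor.obj V) ≫ γ.app V = 𝟙 (P.schurFunctor.obj V)
  right_unit : ∀ V, P.schurFunctor.map (η.app V) ≫ γ.app V = 𝟙 (P.schurFunctor.obj V)

/-- The associated monad as a monad on the category of `R`-modules. -/
@[simps!]
noncomputable def AssociatedMonad.toMonad {P : Operad R} (M : P.AssociatedMonad) :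
    Monad (ModuleCat.{u} R) where
  toFunctor := P.schurFunctor
  η := M.η
  μ := M.γ
  assoc := M.assoc
  left_unit := M.left_unit
  right_unit := M.right_unit

end

end Operad

/-! ### coCartesian differential monads -/

section

variable {C : Type v} [Category.{w} C] [Preadditive C] [HasZeroObject C] [HasBinaryBiproducts C]

/-- A differential combinator transformation on a monad `S` on an additive category; here `A × A` is
the biproduct `A ⊞ A`. A monad together with such a transformation is a coCartesian differential
monad. -/
structure DifferentialCombinatorTransformation (S : Monad C) where
  /-- the components `∂_A : S(A) ⟶ S(A × A)` -/
  app : ∀ A : C, S.obj A ⟶ S.obj (A ⊞ A)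
  naturality : ∀ {A B : C} (f : A ⟶ B), S.map f ≫ app B = app A ≫ S.map (biprod.map f f)
  dc1 : ∀ A : C, app A ≫ S.map (biprod.fst : A ⊞ A ⟶ A) = 0
  dc2 : ∀ A : C,
    app A ≫ S.map (biprod.lift biprod.fst (biprod.lift biprod.snd biprod.snd) :
        A ⊞ A ⟶ A ⊞ (A ⊞ A)) =
      app A ≫ S.map (biprod.lift biprod.fst (biprod.lift biprod.snd 0)) +
        app A ≫ S.map (biprod.lift biprod.fst (biprod.lift 0 biprod.snd))
  dc3 : ∀ A : C, S.η.app A ≫ app A = (biprod.lift 0 (𝟙 A) : A ⟶ A ⊞ A) ≫ S.η.app (A ⊞ A)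
  dc4 : ∀ A : C, S.μ.app A ≫ app A =
    app (S.obj A) ≫
      S.map (biprod.fst ≫ S.map (biprod.lift (𝟙 A) 0 : A ⟶ A ⊞ A) + biprod.snd ≫ app A) ≫
        S.μ.app (A ⊞ A)
  dc5 : ∀ A : C,
    app A ≫ app (A ⊞ A) ≫
        S.map (biprod.lift (biprod.fst ≫ biprod.fst) (biprod.snd ≫ biprod.snd) :
          (A ⊞ A) ⊞ (A ⊞ A) ⟶ A ⊞ A) = app A
  dc6 : ∀ A : C,
    app A ≫ app (A ⊞ A) ≫
        S.map (biprod.lift (biprod.lift (biprod.fst ≫ biprod.fst) (biprod.snd ≫ biprod.fst))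
            (biprod.lift (biprod.fst ≫ biprod.snd) (biprod.snd ≫ biprod.snd)) :
          (A ⊞ A) ⊞ (A ⊞ A) ⟶ (A ⊞ A) ⊞ (A ⊞ A)) =
      app A ≫ app (A ⊞ A)

end

/-! ### Cartesian differential categories -/

section

open CartesianMonoidalCategory
open scoped MonoidalCategory

/-- A Cartesian left additive category, with chosen finite products (`A ⊗ B` is the product): the
hom-sets are commutative monoids, pre-composition is additive, and the projections are additive. -/
class CartesianLeftAdditive (X : Type v) [Category.{w} X] [CartesianMonoidalCategory X] where
  homAdd : ∀ A B : X, AddCommMonoid (A ⟶ B)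
  comp_add : ∀ {A B Z : X} (x : Z ⟶ A) (f g : A ⟶ B), x ≫ (f + g) = x ≫ f + x ≫ g
  comp_zero : ∀ {A B Z : X} (x : Z ⟶ A), x ≫ (0 : A ⟶ B) = 0
  add_fst : ∀ {A B Z : X} (f g : Z ⟶ A ⊗ B), (f + g) ≫ fst A B = f ≫ fst A B + g ≫ fst A B
  zero_fst : ∀ {A B Z : X}, (0 : Z ⟶ A ⊗ B) ≫ fst A B = 0
  add_snd : ∀ {A B Z : X} (f g : Z ⟶ A ⊗ B), (f + g) ≫ snd A B = f ≫ snd A B + g ≫ snd A B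
  zero_snd : ∀ {A B Z : X}, (0 : Z ⟶ A ⊗ B) ≫ snd A B = 0

attribute [reducible, instance] CartesianLeftAdditive.homAdd

/-- A Cartesian differential category: a Cartesian left additive category with a differential
combinator `D`. In `D[f] : A × A ⟶ B` the second argument is the linear one. -/
structure CartesianDifferentialCategory (X : Type v) [Category.{w} X]
    [CartesianMonoidalCategory X] [CartesianLeftAdditive X] where
  /-- the differential combinator -/
  D : ∀ {A B : X}, (A ⟶ B) → (A ⊗ A ⟶ B)
  cd1_add : ∀ {A B : X} (f g : A ⟶ B), D (f + g) = D f + D g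
  cd1_zero : ∀ {A B : X}, D (0 : A ⟶ B) = 0
  cd2_add : ∀ {A B Z : X} (f : A ⟶ B) (x y z : Z ⟶ A),
    lift x (y + z) ≫ D f = lift x y ≫ D f + lift x z ≫ D f
  cd2_zero : ∀ {A B Z : X} (f : A ⟶ B) (x : Z ⟶ A), lift x 0 ≫ D f = 0
  cd3_id : ∀ A : X, D (𝟙 A) = snd A A
  cd3_fst : ∀ A B : X, D (fst A B) = snd (A ⊗ B) (A ⊗ B) ≫ fst A B
  cd3_snd : ∀ A B : X, D (snd A B) = snd (A ⊗ B) (A ⊗ B) ≫ snd A B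
  cd4 : ∀ {A B C : X} (f : A ⟶ B) (g : A ⟶ C), D (lift f g) = lift (D f) (D g)
  cd5 : ∀ {A B C : X} (f : A ⟶ B) (g : B ⟶ C), D (f ≫ g) = lift (fst A A ≫ f) (D f) ≫ D g
  cd6 : ∀ {A B Z : X} (f : A ⟶ B) (x y : Z ⟶ A),
    lift (lift x 0) (lift 0 y) ≫ D (D f) = lift x y ≫ D f
  cd7 : ∀ {A B Z : X} (f : A ⟶ B) (x y z t : Z ⟶ A),
    lift (lift x y) (lift z t) ≫ D (D f) = lift (lift x z) (lift y t) ≫ D (D f)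

end

/-! ### The opposite of the Kleisli category

An arrow `op A ⟶ op B` of `(Kleisli S)ᵒᵖ` is an arrow `B ⟶ S(A)` of the base category. -/

namespace KleisliOp

section

open scoped ZeroObject
open CartesianMonoidalCategory
open scoped MonoidalCategory

variable {C : Type v} [Category.{w} C] (S : Monad C)

/-- Arrows of the opposite Kleisli category as arrows of the base category. -/
def homEquiv (A B : (Kleisli S)ᵒᵖ) : (A ⟶ B) ≃ (B.unop.of ⟶ S.obj A.unop.of) where
  toFun f := f.unop.of
  invFun g := Quiver.Hom.op (X := B.unop) (Y := A.unop) (Kleisli.Hom.mk g)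
  left_inv _ := rfl
  right_inv _ := rfl

theorem homEquiv_comp {A B D : (Kleisli S)ᵒᵖ} (f : A ⟶ B) (g : B ⟶ D) :
    homEquiv S A D (f ≫ g) =
      homEquiv S B D g ≫ S.map (homEquiv S A B f) ≫ S.μ.app A.unop.of := rfl

theorem unit_extend {A B D : C} (x : A ⟶ B) (g : B ⟶ S.obj D) :
    (x ≫ S.η.app B) ≫ S.map g ≫ S.μ.app D = x ≫ g := by
  simp [← S.unit_naturality_assoc]

variable [Preadditive C]

instance (A B : (Kleisli S)ᵒᵖ) : AddCommMonoid (A ⟶ B) :=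
  (homEquiv S A B).addCommMonoid

theorem homEquiv_add {A B : (Kleisli S)ᵒᵖ} (f g : A ⟶ B) :
    homEquiv S A B (f + g) = homEquiv S A B f + homEquiv S A B g := rfl

theorem homEquiv_zero (A B : (Kleisli S)ᵒᵖ) : homEquiv S A B 0 = 0 := rfl

variable [HasZeroObject C] [HasBinaryBiproducts C]

/-- The terminal object of the opposite Kleisli category is the zero object. -/
noncomputable def terminalCone : LimitCone (Functor.empty.{0} (Kleisli S)ᵒᵖ) where
  cone := asEmptyCone (Opposite.op (Kleisli.mk S (0 : C)))
  isLimit := IsTerminal.ofUniqueHom (Y := Opposite.op (Kleisli.mk S (0 : C)))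
    (fun A => (homEquiv S A (Opposite.op (Kleisli.mk S (0 : C)))).symm 0)
    (fun A _ => (homEquiv S A (Opposite.op (Kleisli.mk S (0 : C)))).injective
      ((isZero_zero C).eq_of_src _ _))

/-- The product of `A` and `B` in the opposite Kleisli category is given by the biproduct `A ⊞ B` of
the base category, with projections induced by the injections of the biproduct. -/
noncomputable def productCone (A B : (Kleisli S)ᵒᵖ) : LimitCone (pair A B) where
  cone := BinaryFan.mk (P := Opposite.op (Kleisli.mk S (A.unop.of ⊞ B.unop.of)))
    ((homEquiv S _ A).symm (biprod.inl ≫ S.η.app (A.unop.of ⊞ B.unop.of)))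
    ((homEquiv S _ B).symm (biprod.inr ≫ S.η.app (A.unop.of ⊞ B.unop.of)))
  isLimit := BinaryFan.IsLimit.mk _
    (fun {T} f g => (homEquiv S T (Opposite.op (Kleisli.mk S (A.unop.of ⊞ B.unop.of)))).symm
      (biprod.desc (homEquiv S T A f) (homEquiv S T B g)))
    (fun {T} f g => (homEquiv S T A).injective (by
      simp [homEquiv_comp, ← S.unit_naturality_assoc]))
    (fun {T} f g => (homEquiv S T B).injective (by
      simp [homEquiv_comp, ← S.unit_naturality_assoc]))
    (fun {T} f g m h₁ h₂ =>
      (homEquiv S T (Opposite.op (Kleisli.mk S (A.unop.of ⊞ B.unop.of)))).injective (by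
        subst h₁ h₂
        apply biprod.hom_ext' <;> simp [homEquiv_comp, ← S.unit_naturality_assoc]))

noncomputable instance : CartesianMonoidalCategory (Kleisli S)ᵒᵖ :=
  CartesianMonoidalCategory.ofChosenFiniteProducts (terminalCone S) (productCone S)

theorem homEquiv_fst (A B : (Kleisli S)ᵒᵖ) :
    homEquiv S (A ⊗ B) A (fst A B) = biprod.inl ≫ S.η.app (A.unop.of ⊞ B.unop.of) := rfl

theorem homEquiv_snd (A B : (Kleisli S)ᵒᵖ) :
    homEquiv S (A ⊗ B) B (snd A B) = biprod.inr ≫ S.η.app (A.unop.of ⊞ B.unop.of) := rfl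

theorem homEquiv_comp_fst {A B Z : (Kleisli S)ᵒᵖ} (f : Z ⟶ A ⊗ B) :
    homEquiv S Z A (f ≫ fst A B) = biprod.inl ≫ homEquiv S Z (A ⊗ B) f := by
  exact unit_extend S (biprod.inl : _ ⟶ A.unop.of ⊞ B.unop.of) (homEquiv S Z (A ⊗ B) f)

theorem homEquiv_comp_snd {A B Z : (Kleisli S)ᵒᵖ} (f : Z ⟶ A ⊗ B) :
    homEquiv S Z B (f ≫ snd A B) = biprod.inr ≫ homEquiv S Z (A ⊗ B) f := by
  exact unit_extend S (biprod.inr : _ ⟶ A.unop.of ⊞ B.unop.of) (homEquiv S Z (A ⊗ B) f)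

/-- The Cartesian left additive structure of the opposite Kleisli category: arrows are added as
arrows of the base category. -/
instance : CartesianLeftAdditive (Kleisli S)ᵒᵖ where
  homAdd A B := inferInstance
  comp_add x f g := (homEquiv S _ _).injective (by
    rw [homEquiv_add, homEquiv_comp, homEquiv_comp, homEquiv_comp, homEquiv_add]
    exact Preadditive.add_comp _ _ _ _ _ _)
  comp_zero x := (homEquiv S _ _).injective (by
    rw [homEquiv_comp, homEquiv_zero]
    exact zero_comp)
  add_fst f g := (homEquiv S _ _).injective (by
    rw [homEquiv_add, homEquiv_comp_fst, homEquiv_comp_fst, homEquiv_comp_fst, homEquiv_add]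
    exact Preadditive.comp_add _ _ _ _ _ _)
  zero_fst := (homEquiv S _ _).injective (by
    rw [homEquiv_comp_fst]
    exact comp_zero)
  add_snd f g := (homEquiv S _ _).injective (by
    rw [homEquiv_add, homEquiv_comp_snd, homEquiv_comp_snd, homEquiv_comp_snd, homEquiv_add]
    exact Preadditive.comp_add _ _ _ _ _ _)
  zero_snd := (homEquiv S _ _).injective (by
    rw [homEquiv_comp_snd]
    exact comp_zero)

end

end KleisliOp

/-! The delicate point is the multiplication: complete composition must be linear in each argument,
compatible with both layers of coinvariants, and associative. It is defined by one order of
plugging, while the axioms concern single partial compositions, so composition is treated as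
rewriting. A `Term` is an operation whose inputs carry either plain labels or labelled operations,
and a `Plug` step plugs in one of the latter. The parallel axiom makes steps at different inputs
commute (`plug_diamond`), so by Church–Rosser a term has at most one value in S(P, V)
(`Evals.unique`). One particular order yields μ(ν₁, …, νₖ) (`comp_plugs`), and equivariance of
partial composition gives both coinvariant relations (`total_act`, `total_update_act`). Composition
therefore extends from generators to a multilinear action `algMap` of P on S(P, V). The sequential
axiom makes it compatible with partial composition (`algMap_circ`), so evaluating labels commutes
with plugging (`algMap_plugs`), which is associativity of γ.

The transformation ∂ is the case f = inl, g = inr of `dirDeriv f g`, which applies g in one slot and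
f in the others and sums over the slots. Its axioms are formal rules for this operator:
functoriality, additivity in g, the Leibniz rule `dirDeriv_mulMap`, and two facts about a double sum
over slots. If mixed terms die, only the diagonal is left (`dirDeriv_dirDeriv_diag`); exchanging the
two sums gives symmetry (`dirDeriv_dirDeriv_comm`).

For any coCartesian differential monad, arrows into a product in the opposite Kleisli category are
copairings out of a biproduct. Substituting arbitrary arrows then turns dc1 and dc2 into additivity
of D[f] in its second argument, dc3 into the rules for identities and projections, dc4 into the
chain rule, and dc5 and dc6 into cd6 and cd7. The rules cd1 and cd4 only use additivity of
composition and the biproduct. -/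

namespace Operad

/-! ### Confluent rewriting of terms by partial composition -/

section Plugging

/-- The labels of the inputs of a partial composite: those of the outer operation, with the label
of input `i` replaced by the labels of the inner operation. -/
def insertAt {B : Type*} {m n p : ℕ} (i : Fin m) (h : p + 1 = m + n) (u : Fin m → B)
    (w : Fin n → B) (s : Fin p) : B :=
  if h₁ : s.1 < i.1 then u ⟨s, by have := i.2; omega⟩
  else if h₂ : s.1 < i + n then w ⟨s - i, by omega⟩
  else u ⟨s + 1 - n, by have := s.2; omega⟩

theorem insertAt_block {B : Type*} {m n p : ℕ} (i : Fin m) (h : p + 1 = m + n) (u : Fin m → B)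
    (w : Fin n → B) (x : {j : Fin m // j ≠ i} ⊕ Fin n) :
    insertAt i h u w (block i h x) = Sum.elim (fun j => u j.1) w x := by
  obtain ⟨⟨j, hj⟩, hji⟩ | k := x
  · have hne : j ≠ i.1 := fun e => hji (Fin.ext e)
    simp only [block, Equiv.ofBijective_apply, blockFun, insertAt, Sum.elim_inl, Fin.lt_def]
    split_ifs <;> first | rfl | (congr 1; apply Fin.ext; simp only; omega) | (exfalso; simp only [] at *; omega)
  · have := k.2
    simp only [block, Equiv.ofBijective_apply, blockFun, insertAt, Sum.elim_inr]
    split_ifs <;> first | (congr 1; apply Fin.ext; simp only; omega) | (exfalso; omega)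

theorem insertAt_comp {B B' : Type*} {m n p : ℕ} (i : Fin m) (h : p + 1 = m + n) (u : Fin m → B)
    (w : Fin n → B) (f : B → B') :
    (fun s => f (insertAt i h u w s)) = insertAt i h (fun j => f (u j)) (fun j => f (w j)) := by
  funext s
  simp only [insertAt, apply_dite f]

theorem insertAt_comp_innerPerm {B : Type*} {m n p : ℕ} (i : Fin m) (h : p + 1 = m + n)
    (u : Fin m → B) (w : Fin n → B) (σ : Equiv.Perm (Fin n)) :
    insertAt i h u w ∘ ⇑(innerPerm i h σ)⁻¹ = insertAt i h u (w ∘ ⇑σ⁻¹) := by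
  funext s
  obtain ⟨x, rfl⟩ := (block i h).surjective s
  have : (innerPerm i h σ)⁻¹ (block i h x) = block i h (Equiv.sumCongr (Equiv.refl _) σ.symm x) := by
    rw [Equiv.Perm.inv_eq_iff_eq]
    cases x <;> simp [innerPerm]
  rw [Function.comp_apply, this, insertAt_block, insertAt_block]
  cases x <;> rfl

theorem insertAt_comp_outerPerm {B : Type*} {m n p : ℕ} (i : Fin m) (h : p + 1 = m + n)
    (u : Fin m → B) (w : Fin n → B) (σ : Equiv.Perm (Fin m)) :
    insertAt i h u w ∘ ⇑(outerPerm i h σ)⁻¹ = insertAt (σ i) h (u ∘ ⇑σ⁻¹) w := by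
  funext s
  obtain ⟨y, rfl⟩ := ((block i h).trans (outerPerm i h σ)).surjective s
  have key : outerPerm i h σ (block i h y) = block (σ i) h (Equiv.sumCongr
      (σ.subtypeEquiv (fun _ => (EmbeddingLike.apply_eq_iff_eq σ).not.symm)) (Equiv.refl _) y) := by
    simp [outerPerm]
  rw [Function.comp_apply, Equiv.trans_apply, Equiv.Perm.inv_eq_iff_eq.2 rfl, key, insertAt_block,
    insertAt_block]
  cases y <;> simp

theorem insertAt_insertAt {B : Type*} {l m n p q r : ℕ} (i : Fin l) (j : Fin m)
    (hp : p + 1 = l + m) (hq : q + 1 = p + n) (hr : r + 1 = m + n) (hq' : q + 1 = l + r)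
    (u : Fin l → B) (v : Fin m → B) (w : Fin n → B) (hij : i.1 + j.1 < p) :
    insertAt (⟨i + j, hij⟩ : Fin p) hq (insertAt i hp u v) w
      = insertAt i hq' u (insertAt j hr v w) := by
  funext s
  have := j.2
  simp only [insertAt]
  split_ifs <;> first | rfl | (exfalso; omega) | (congr 1; apply Fin.ext; simp only; omega)

theorem insertAt_comm {B : Type*} {l m n p q r : ℕ} (i k : Fin l) (hik : i < k)
    (hp : p + 1 = l + m) (hq : q + 1 = p + n) (hr : r + 1 = l + n) (hq' : q + 1 = r + m)
    (u : Fin l → B) (v : Fin m → B) (w : Fin n → B) (hk : k.1 + m - 1 < p) (hi : i.1 < r) :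
    insertAt (⟨k + m - 1, hk⟩ : Fin p) hq (insertAt i hp u v) w
      = insertAt (⟨i, hi⟩ : Fin r) hq' (insertAt k hr u w) v := by
  funext s
  rw [Fin.lt_def] at hik
  simp only [insertAt]
  split_ifs <;> first | rfl | (exfalso; omega) | (congr 1; apply Fin.ext; simp only; omega)

theorem insertAt_apply_before {B : Type*} {m n p : ℕ} (i j : Fin m) (h : p + 1 = m + n)
    (u : Fin m → B) (w : Fin n → B) (hj : j < i) (s : Fin p) (hs : s.1 = j) :
    insertAt i h u w s = u j := by
  rw [Fin.lt_def] at hj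
  simp only [insertAt]
  rw [dif_pos (by omega)]
  congr 1
  exact Fin.ext hs

theorem insertAt_apply_inside {B : Type*} {m n p : ℕ} (i : Fin m) (h : p + 1 = m + n)
    (u : Fin m → B) (w : Fin n → B) (j : Fin n) (s : Fin p) (hs : s.1 = i + j) :
    insertAt i h u w s = w j := by
  have := j.2
  simp only [insertAt]
  rw [dif_neg (by omega), dif_pos (by omega)]
  congr 1
  apply Fin.ext
  simp only
  omega

theorem insertAt_apply_after {B : Type*} {m n p : ℕ} (i j : Fin m) (h : p + 1 = m + n)
    (u : Fin m → B) (w : Fin n → B) (hj : i < j) (s : Fin p) (hs : s.1 + 1 = j + n) :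
    insertAt i h u w s = u j := by
  rw [Fin.lt_def] at hj
  simp only [insertAt]
  rw [dif_neg (by omega), dif_neg (by omega)]
  congr 1
  apply Fin.ext
  simp only
  omega

variable {R : Type u} [CommRing R] (P : Operad R)

/-- Operations with labelled inputs. -/
abbrev Labelled (A : Type u) : Type u := Σ n : ℕ, P.obj n × (Fin n → A)

/-- Operations of which each input is labelled by an element of `A` or by an operation whose inputs
are labelled by elements of `A`. -/
abbrev Term (A : Type u) : Type u := P.Labelled (A ⊕ P.Labelled A)

variable {P} {A : Type u}

/-- One step of a complete composition: a label that is an operation is plugged in. -/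
inductive Plug : P.Term A → P.Term A → Prop
  | plug {m n p : ℕ} (i : Fin m) (h : p + 1 = m + n) (μ : P.obj m) (ν : P.obj n)
      (u : Fin m → A ⊕ P.Labelled A) (w : Fin n → A) (hu : u i = .inr ⟨n, ν, w⟩) :
      Plug ⟨m, μ, u⟩ ⟨p, P.circ i h μ ν, insertAt i h u fun j => .inl (w j)⟩

/-- The parallel axiom closes the square: plugging at `i` moves input `k` to `k + m - 1`, while
plugging at `k` leaves input `i` in place. -/
theorem plug_diamond_of_lt {l m n p r : ℕ} (i k : Fin l) (hik : i < k) (hp : p + 1 = l + m)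
    (hr : r + 1 = l + n) (lam : P.obj l) (μ : P.obj m) (ν : P.obj n)
    (u : Fin l → A ⊕ P.Labelled A) (v : Fin m → A) (w : Fin n → A)
    (hi : u i = .inr ⟨m, μ, v⟩) (hk : u k = .inr ⟨n, ν, w⟩) :
    ∃ c, Plug ⟨p, P.circ i hp lam μ, insertAt i hp u fun j => .inl (v j)⟩ c ∧
      Plug ⟨r, P.circ k hr lam ν, insertAt k hr u fun j => .inl (w j)⟩ c := by
  have hik' := Fin.lt_def.1 hik
  have hk2 := k.2
  obtain ⟨q, hq⟩ : ∃ q, q + 1 = p + n := ⟨p + n - 1, by omega⟩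
  have hkp : k.1 + m - 1 < p := by omega
  have hir : i.1 < r := by omega
  refine ⟨_, .plug (⟨k + m - 1, hkp⟩ : Fin p) hq _ ν _ w ?_, ?_⟩
  · rw [insertAt_apply_after i k hp _ _ hik _ (by simp only; omega), hk]
  · rw [P.circ_comm i k hik hp hq hr (by omega), insertAt_comm i k hik hp hq hr (by omega) _ _ _ hkp hir]
    refine .plug (⟨i, hir⟩ : Fin r) _ _ μ _ v ?_
    rw [insertAt_apply_before k i hr _ _ hik _ rfl, hi]

theorem plug_diamond {a b c : P.Term A} (hb : Plug a b) (hc : Plug a c) :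
    ∃ d, Relation.ReflGen Plug b d ∧ Relation.ReflTransGen Plug c d := by
  obtain ⟨i, hp, lam, μ, u, v, hi⟩ := hb
  obtain ⟨k, hr, _, ν, _, w, hk⟩ := hc
  rcases lt_trichotomy i k with hik | rfl | hik
  · obtain ⟨d, h₁, h₂⟩ := plug_diamond_of_lt i k hik hp hr lam μ ν u v w hi hk
    exact ⟨d, .single h₁, .single h₂⟩
  -- At the same input both steps plug in the same operation, and the arity equations force the same
  -- arity, so the results coincide.
  · rw [hi] at hk
    obtain ⟨⟩ := hk
    obtain rfl := Nat.succ_injective (hp.trans hr.symm)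
    exact ⟨_, .refl, .refl⟩
  · obtain ⟨d, h₁, h₂⟩ := plug_diamond_of_lt k i hik hr hp lam ν μ u w v hk hi
    exact ⟨d, .single h₂, .single h₁⟩

/-- Terms with plain labels only are normal forms. -/
theorem not_plug_inl {n : ℕ} (μ : P.obj n) (v : Fin n → A) (t : P.Term A) :
    ¬ Plug ⟨n, μ, fun j => .inl (v j)⟩ t := by
  rintro ⟨i, h, μ, ν, u, w, hu⟩
  cases hu

theorem eq_of_plugs_inl {n : ℕ} {μ : P.obj n} {v : Fin n → A} {t : P.Term A}
    (h : Relation.ReflTransGen Plug ⟨n, μ, fun j => .inl (v j)⟩ t) :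
    t = ⟨n, μ, fun j => .inl (v j)⟩ := by
  rcases h.cases_head with h | ⟨c, h, -⟩
  · exact h.symm
  · exact absurd h (not_plug_inl _ _ _)

/-- Plugging in inside the inner operation of a composite. -/
theorem Plug.circ {m n r p q : ℕ} {ν : P.obj n} {ν' : P.obj r} {y : Fin n → A ⊕ P.Labelled A}
    {y' : Fin r → A ⊕ P.Labelled A} (h : Plug ⟨n, ν, y⟩ ⟨r, ν', y'⟩) (i : Fin m)
    (hp : p + 1 = m + n) (hq : q + 1 = m + r) (μ : P.obj m) (u : Fin m → A ⊕ P.Labelled A) :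
    Plug ⟨p, P.circ i hp μ ν, insertAt i hp u y⟩ ⟨q, P.circ i hq μ ν', insertAt i hq u y'⟩ := by
  obtain ⟨j, hr, _, ζ, _, w, hy⟩ := h
  have hij : i.1 + j.1 < p := by have := i.2; have := j.2; omega
  rename_i s
  have hq' : q + 1 = p + s := by omega
  -- By the sequential axiom, a step at input `j` of the inner operation is a step at input `i + j`
  -- of the composite.
  rw [← P.circ_assoc i j hp hq' hr hq, ← insertAt_insertAt i j hp hq' hr hq _ _ _ hij]
  exact .plug _ hq' _ ζ _ w (by rw [insertAt_apply_inside _ _ _ _ j _ rfl, hy])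

theorem plugs_circ {m n r p q : ℕ} {ν : P.obj n} {ν' : P.obj r} {y : Fin n → A ⊕ P.Labelled A}
    {y' : Fin r → A ⊕ P.Labelled A} (h : Relation.ReflTransGen Plug ⟨n, ν, y⟩ ⟨r, ν', y'⟩)
    (i : Fin m) (hp : p + 1 = m + n) (hq : q + 1 = m + r) (μ : P.obj m)
    (u : Fin m → A ⊕ P.Labelled A) :
    Relation.ReflTransGen Plug ⟨p, P.circ i hp μ ν, insertAt i hp u y⟩
      ⟨q, P.circ i hq μ ν', insertAt i hq u y'⟩ := by
  have hm := i.2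
  -- The composite's arity is written as a function of the inner arity, so that composing becomes a
  -- map on terms along which reductions can be lifted.
  have key := Relation.ReflTransGen.lift (r := Plug) (p := Plug)
    (fun t : P.Term A => (⟨m + t.1 - 1, P.circ i (by omega) μ t.2.1,
      insertAt i (by omega) u t.2.2⟩ : P.Term A))
    (fun _ _ hab => Plug.circ hab i _ _ μ u) _ _ h
  obtain rfl : p = m + n - 1 := by omega
  obtain rfl : q = m + r - 1 := by omega
  exact key

/-- Two terms that differ by a permutation of the inputs. -/
inductive PermRel : P.Labelled A → P.Labelled A → Prop
  | perm {m : ℕ} (σ : Equiv.Perm (Fin m)) (μ : P.obj m) (u : Fin m → A) :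
      PermRel ⟨m, P.act σ μ, u⟩ ⟨m, μ, u ∘ ⇑σ⁻¹⟩

/-- Outer equivariance: a step at `i` in μ · σ is matched by one at `σ i` in μ, and the results
differ by the induced block permutation. -/
theorem PermRel.plug {a a' b : P.Term A} (h : PermRel a a') (hb : Plug a b) :
    ∃ b', Plug a' b' ∧ PermRel b b' := by
  obtain ⟨σ, μ, u⟩ := h
  obtain ⟨i, hp, _, ν, _, w, hi⟩ := hb
  rw [P.act_circ]
  refine ⟨_, .plug (σ i) hp μ ν _ w (by simp [hi]), ?_⟩
  rw [← insertAt_comp_outerPerm]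
  exact .perm _ _ _

theorem PermRel.plugs {a a' b : P.Term A} (h : PermRel a a') (hb : Relation.ReflTransGen Plug a b) :
    ∃ b', Relation.ReflTransGen Plug a' b' ∧ PermRel b b' := by
  induction hb with
  | refl => exact ⟨a', .refl, h⟩
  | tail _ hbc ih =>
    obtain ⟨b', hab', hb'⟩ := ih
    obtain ⟨c', hc', hcc'⟩ := hb'.plug hbc
    exact ⟨c', hab'.tail hc', hcc'⟩

/-- The final labelling `z` is specified by positions and stays fixed in the induction: `hz`
describes the consecutive blocks coming from the first `k` inputs, and `hz'` the shifted inputs that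
are left alone. -/
theorem compAux_plugs (k : ℕ) {p q : ℕ} (n : Fin k → ℕ) (hk : k ≤ p) (h : q + k = p + ∑ j, n j)
    (μ : P.obj p) (ν : ∀ j, P.obj (n j)) (w : ∀ j, Fin (n j) → A) (u : Fin p → A ⊕ P.Labelled A)
    (hu : ∀ j : Fin k, u (j.castLE hk) = .inr ⟨n j, ν j, w j⟩) (z : Fin q → A ⊕ P.Labelled A)
    (hz : ∀ (j : Fin k) (t : Fin (n j)) (s : Fin q),
      s.1 = ∑ i : Fin j.1, n (i.castLE j.2.le) + t → z s = .inl (w j t))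
    (hz' : ∀ (r : Fin p) (s : Fin q), k ≤ r.1 → s + k = ∑ j, n j + r → z s = u r) :
    Relation.ReflTransGen Plug ⟨p, μ, u⟩ ⟨q, P.compAux k n hk h μ ν, z⟩ := by
  induction k generalizing p q with
  | zero =>
    obtain rfl : p = q := by simp at h; omega
    obtain rfl : z = u := funext fun s => hz' s s (by simp) (by simp)
    exact .refl
  | succ k ih =>
    have hsum := Fin.sum_univ_castSucc n
    refine .head (Plug.plug ⟨k, hk⟩ (p := p + n (Fin.last k) - 1) (by omega) μ (ν (Fin.last k)) u
      (w (Fin.last k)) (hu (Fin.last k))) ?_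
    refine ih (fun j => n j.castSucc) _ _ _ _ (fun j => w j.castSucc) _ ?_ _ ?_ ?_
    · intro j
      refine (insertAt_apply_before ⟨k, hk⟩ (j.castSucc.castLE hk) _ _ _ (Fin.lt_def.2 j.2) _
        ?_).trans (hu j.castSucc)
      rfl
    · intro j t s hs
      exact hz j.castSucc t s hs
    · intro r s hr hs
      -- After input `k` is filled, the inputs from `k` on are the block just inserted, governed by
      -- `hz` at the last index, followed by the old later inputs, governed by `hz'`.
      by_cases hrn : r.1 < k + n (Fin.last k)
      · rw [insertAt_apply_inside _ _ _ _ ⟨r - k, by omega⟩ _ (by simp only; omega)]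
        refine hz (Fin.last k) ⟨r - k, by omega⟩ s ?_
        have : ∑ i : Fin (Fin.last k).1, n (i.castLE (Fin.last k).2.le)
          = ∑ j : Fin k, n j.castSucc := rfl
        rw [this]
        simp only
        omega
      · have hr2 := r.2
        rw [insertAt_apply_after _ ⟨r + 1 - n (Fin.last k), by omega⟩ _ _ _
          (by simp [Fin.lt_def]; omega) _ (by simp only; omega)]
        refine hz' _ s (by simp only; omega) (by simp only; omega)

/-- A term all of whose labels are operations reduces to the complete composition. -/
theorem comp_plugs {k : ℕ} (μ : P.obj k) (x : Fin k → P.Labelled A) :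
    Relation.ReflTransGen Plug ⟨k, μ, fun j => .inr (x j)⟩
      ⟨_, P.comp μ (fun j => (x j).2.1), fun s => .inl
        ((x (finSigmaFinEquiv.symm s).1).2.2 (finSigmaFinEquiv.symm s).2)⟩ := by
  refine compAux_plugs k (fun j => (x j).1) _ _ μ _ (fun j => (x j).2.2) _ (fun _ => rfl) _ ?_ ?_
  · intro j t s hs
    obtain rfl : s = finSigmaFinEquiv ⟨j, t⟩ := Fin.ext (by rw [hs, finSigmaFinEquiv_apply])
    rw [Equiv.symm_apply_apply]
  · intro r s hr
    have := r.2
    omega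

end Plugging

end Operad

/-! ### Multilinear extension from spanning families -/

section SeparatelyLinear

variable {R : Type*} [CommRing R] {ι X Y M M' N : Type*} [AddCommGroup M] [Module R M]
  [AddCommGroup M'] [Module R M'] [AddCommGroup N] [Module R N]

/-- A function of several variables that is linear in each of them. -/
def SeparatelyLinear (R : Type*) [CommRing R] {ι M N : Type*} [AddCommGroup M] [Module R M]
    [AddCommGroup N] [Module R N] [DecidableEq ι] (F : (ι → M) → N) : Prop :=
  ∀ (z : ι → M) (j : ι), ∃ L : M →ₗ[R] N, ∀ a, F (Function.update z j a) = L a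

theorem MultilinearMap.separatelyLinear [DecidableEq ι] (F : MultilinearMap R (fun _ : ι => M) N) :
    SeparatelyLinear R F :=
  fun z j => ⟨F.toLinearMap z j, fun _ => rfl⟩

/-- Variables are freed from the generators one at a time. Linearity in each variable is all that is
needed, so a nested composite need not be packaged as a `MultilinearMap`. -/
theorem SeparatelyLinear.eq_of_span_eq_top [Fintype ι] [DecidableEq ι] {F G : (ι → M) → N}
    (hF : SeparatelyLinear R F) (hG : SeparatelyLinear R G) {g : X → M}
    (hg : Submodule.span R (Set.range g) = ⊤)
    (h : ∀ x : ι → X, F (fun j => g (x j)) = G (fun j => g (x j))) : F = G := by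
  have key : ∀ (s : Finset ι) (z : ι → M), (∀ j ∉ s, z j ∈ Set.range g) → F z = G z := by
    intro s
    induction s using Finset.induction_on with
    | empty =>
      intro z hz
      choose x hx using fun j => hz j (by simp)
      obtain rfl : (fun j => g (x j)) = z := funext hx
      exact h x
    | insert j s _ ih =>
      intro z hz
      obtain ⟨L, hL⟩ := hF z j
      obtain ⟨L', hL'⟩ := hG z j
      have : L = L' := by
        refine LinearMap.ext_on_range hg fun a => ?_
        rw [← hL, ← hL']
        refine ih _ fun i hi => ?_
        by_cases hij : i = j
        · subst hij
          simp
        · rw [Function.update_of_ne hij]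
          exact hz i (by simp [hij, hi])
      rw [← Function.update_eq_self j z, hL, hL', this]
  exact funext fun z => key Finset.univ z (by simp)

/-- For each `m` in the span of `g`, span induction extends `y ↦ L y m` linearly along `g'`. As `g'`
spans, this extension is unique, and uniqueness makes it linear in `m`. -/
theorem exists_bilinear_of_span_eq_top {g : X → M} (hg : Submodule.span R (Set.range g) = ⊤)
    {g' : Y → M'} (hg' : Submodule.span R (Set.range g') = ⊤) (f : X → Y → N)
    (h : ∀ y, ∃ L : M →ₗ[R] N, ∀ x, f x y = L (g x))
    (h' : ∀ x, ∃ L : M' →ₗ[R] N, ∀ y, f x y = L (g' y)) :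
    ∃ B : M →ₗ[R] M' →ₗ[R] N, ∀ x y, B (g x) (g' y) = f x y := by
  choose L hL using h
  have key : ∀ m : M, ∃ l : M' →ₗ[R] N, ∀ y, l (g' y) = L y m := by
    intro m
    have hm : m ∈ Submodule.span R (Set.range g) := hg ▸ Submodule.mem_top
    induction hm using Submodule.span_induction with
    | mem m hm =>
      obtain ⟨x, rfl⟩ := hm
      obtain ⟨l, hl⟩ := h' x
      exact ⟨l, fun y => by rw [← hl, hL]⟩
    | zero => exact ⟨0, by simp⟩
    | add a b _ _ ha hb =>
      obtain ⟨l, hl⟩ := ha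
      obtain ⟨l', hl'⟩ := hb
      exact ⟨l + l', fun y => by simp [hl, hl']⟩
    | smul c a _ ha =>
      obtain ⟨l, hl⟩ := ha
      exact ⟨c • l, fun y => by simp [hl]⟩
  choose l hl using key
  refine ⟨⟨⟨l, fun a b => LinearMap.ext_on_range hg' fun y => ?_⟩, fun c a =>
    LinearMap.ext_on_range hg' fun y => ?_⟩, fun x y => ?_⟩
  · simp [hl]
  · simp [hl]
  · exact (hl _ _).trans (hL y x).symm

/-- A function on tuples of generators that extends to a linear map in each variable extends to a
multilinear map. -/
theorem exists_multilinearMap_of_span_eq_top {X : Type*} {M N : Type w} [AddCommGroup M]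
    [Module R M] [AddCommGroup N] [Module R N] {g : X → M}
    (hg : Submodule.span R (Set.range g) = ⊤) (k : ℕ) (F : (Fin k → X) → N)
    (h : ∀ (x : Fin k → X) (j : Fin k),
      ∃ L : M →ₗ[R] N, ∀ a, F (Function.update x j a) = L (g a)) :
    ∃ Φ : MultilinearMap R (fun _ : Fin k => M) N, ∀ x, Φ (fun j => g (x j)) = F x := by
  induction k generalizing N with
  | zero =>
    refine ⟨MultilinearMap.constOfIsEmpty R _ (F Fin.elim0), fun x => ?_⟩
    rw [MultilinearMap.constOfIsEmpty_apply, Function.const_apply, Subsingleton.elim x Fin.elim0]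
  | succ k ih =>
    have h₁ : ∀ x : Fin k → X, ∃ L : M →ₗ[R] N, ∀ a,
        F (Fin.snoc (α := fun _ => X) x a) = L (g a) := by
      intro x
      by_cases hX : Nonempty X
      · obtain ⟨a₀⟩ := hX
        obtain ⟨L, hL⟩ := h (Fin.snoc (α := fun _ => X) x a₀) (Fin.last k)
        exact ⟨L, fun a => by rw [← hL, Fin.update_snoc_last]⟩
      · exact ⟨0, fun a => (hX ⟨a⟩).elim⟩
    -- The last variable is absorbed into the target: the induction hypothesis is used with values
    -- in `M →ₗ[R] N`, which is why `M` and `N` share a universe.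
    choose L hL using h₁
    obtain ⟨Φ, hΦ⟩ := ih L (by
      intro x j
      obtain ⟨B, hB⟩ := exists_bilinear_of_span_eq_top (R := R) hg hg
        (fun a b => F (Fin.snoc (α := fun _ => X) (Function.update x j a) b))
        (fun b => by
          obtain ⟨l, hl⟩ := h (Fin.snoc (α := fun _ => X) x b) j.castSucc
          exact ⟨l, fun a => by rw [← hl, Fin.snoc_update]⟩)
        (fun a => ⟨L _, fun b => hL _ b⟩)
      refine ⟨B, fun a => LinearMap.ext_on_range hg fun b => ?_⟩
      rw [← hL, hB])
    refine ⟨Φ.uncurryRight, fun x => ?_⟩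
    rw [MultilinearMap.uncurryRight_apply]
    have : Fin.init (fun j => g (x j)) = fun j => g (Fin.init x j) := rfl
    rw [this, hΦ, ← hL, Fin.snoc_init_self]

end SeparatelyLinear

/-! ### The action of P on S(P, V), the multiplication and the monad laws -/

namespace Operad

section Multiplication

variable {R : Type u} [CommRing R] {P : Operad R} {V : Type u} [AddCommGroup V] [Module R V]
  {N : Type*} [AddCommGroup N] [Module R N]

variable (P V) in
/-- The element of `S(P, V)` given by an operation labelled by elements of `V`. -/
noncomputable def gen (t : P.Labelled V) : P.Schur V := P.elt t.2.1 t.2.2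

variable (P V) in
theorem span_range_gen : Submodule.span R (Set.range (P.gen V)) = ⊤ := by
  rw [← Submodule.ker_mkQ (Submodule.span R (Set.range (P.gen V))), LinearMap.ker_eq_top]
  refine P.schur_hom_ext fun n μ v => ?_
  simp only [Submodule.mkQ_apply, LinearMap.zero_apply, Submodule.Quotient.mk_eq_zero]
  exact Submodule.subset_span ⟨⟨n, μ, v⟩, rfl⟩

theorem elt_act {n : ℕ} (σ : Equiv.Perm (Fin n)) (μ : P.obj n) (v : Fin n → V) :
    P.elt (P.act σ μ) v = P.elt μ (v ∘ ⇑σ⁻¹) := by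
  have h := Representation.Coinvariants.mk_self_apply (P.diagRep n V) σ
    (P.act σ μ ⊗ₜ[R] PiTensorProduct.tprod R v)
  have h₁ : P.rep n σ (P.act σ μ) = μ := by
    change P.act σ⁻¹ (P.act σ μ) = μ
    rw [← P.act_mul, mul_inv_cancel, P.act_one]
  have h₂ : permRep R n V σ (PiTensorProduct.tprod R v) = PiTensorProduct.tprod R (v ∘ ⇑σ⁻¹) :=
    PiTensorProduct.reindex_tprod _ _
  rw [Representation.tprod_apply, TensorProduct.map_tmul, h₁, h₂] at h
  rw [elt, elt, ← h]

/-- The linear map on `S(P, V)` with given values on the elements `(μ; v₁, …, vₙ)`. -/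
noncomputable def schurLift (f : ∀ n, P.obj n →ₗ[R] MultilinearMap R (fun _ : Fin n => V) N)
    (hf : ∀ n (σ : Equiv.Perm (Fin n)) (μ : P.obj n) (v : Fin n → V),
      f n (P.act σ μ) v = f n μ (v ∘ ⇑σ⁻¹)) : P.Schur V →ₗ[R] N :=
  DirectSum.toModule R ℕ _ fun n =>
    Representation.Coinvariants.lift (P.diagRep n V)
      (TensorProduct.lift (PiTensorProduct.lift (R := R).toLinearMap ∘ₗ f n)) (by
        intro σ
        apply TensorProduct.ext
        ext μ v
        have h₂ : permRep R n V σ (PiTensorProduct.tprod R v)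
          = PiTensorProduct.tprod R (v ∘ ⇑σ⁻¹) := PiTensorProduct.reindex_tprod _ _
        have h₁ : P.act σ (P.rep n σ μ) = μ := by
          change P.act σ (P.act σ⁻¹ μ) = μ
          rw [← P.act_mul, inv_mul_cancel, P.act_one]
        simp [h₂, ← hf, h₁, -Equiv.Perm.coe_inv])

theorem schurLift_elt (f : ∀ n, P.obj n →ₗ[R] MultilinearMap R (fun _ : Fin n => V) N)
    (hf : ∀ n (σ : Equiv.Perm (Fin n)) (μ : P.obj n) (v : Fin n → V),
      f n (P.act σ μ) v = f n μ (v ∘ ⇑σ⁻¹)) {n : ℕ} (μ : P.obj n) (v : Fin n → V) :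
    schurLift f hf (P.elt μ v) = f n μ v := by
  simp [schurLift, elt, DirectSum.toModule_lof]

variable (P V) in
/-- `elt` as a multilinear map. -/
noncomputable def eltHom (n : ℕ) :
    P.obj n →ₗ[R] MultilinearMap R (fun _ : Fin n => V) (P.Schur V) where
  toFun μ := (DirectSum.lof R ℕ (fun n => (P.diagRep n V).Coinvariants) n ∘ₗ
    Representation.Coinvariants.mk (P.diagRep n V) ∘ₗ
      TensorProduct.mk R _ _ μ).compMultilinearMap (PiTensorProduct.tprod R)
  map_add' μ ν := by
    ext v
    simp
  map_smul' c μ := by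
    ext v
    simp

theorem eltHom_apply {n : ℕ} (μ : P.obj n) (v : Fin n → V) : P.eltHom V n μ v = P.elt μ v := rfl

/-- The value of a term: all labels that are operations are plugged in. -/
def Evals (t : P.Term V) (s : P.Schur V) : Prop :=
  ∃ (n : ℕ) (μ : P.obj n) (v : Fin n → V),
    Relation.ReflTransGen Plug t ⟨n, μ, fun j => .inl (v j)⟩ ∧ P.elt μ v = s

/-- Confluence: the normal form giving the value and the term `t'` have a common reduct, which can
only be that normal form. -/
theorem Evals.plugs {t t' : P.Term V} {s : P.Schur V} (hs : Evals t s)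
    (h : Relation.ReflTransGen Plug t t') : Evals t' s := by
  obtain ⟨n, μ, v, h', hs⟩ := hs
  obtain ⟨c, h₁, h₂⟩ := Relation.church_rosser (fun _ _ _ => plug_diamond) h' h
  obtain rfl := eq_of_plugs_inl h₁
  exact ⟨n, μ, v, h₂, hs⟩

theorem Evals.permRel {t t' : P.Term V} {s : P.Schur V} (hs : Evals t s) (h : PermRel t t') :
    Evals t' s := by
  obtain ⟨n, μ, v, h', hs⟩ := hs
  obtain ⟨b, hb, hb'⟩ := h.plugs h'
  obtain ⟨σ, μ, -⟩ := hb'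
  exact ⟨n, μ, v ∘ ⇑σ⁻¹, hb, by rw [← elt_act, hs]⟩

theorem Evals.unique {t : P.Term V} {s s' : P.Schur V} (hs : Evals t s) (hs' : Evals t s') :
    s = s' := by
  obtain ⟨n, μ, v, h, rfl⟩ := hs
  obtain ⟨n', μ', v', h', rfl⟩ := hs'.plugs h
  -- The `Sum.elim` strips the plain labels; its value 0 on operations is never met in a normal
  -- form.
  have := congrArg (fun t : P.Term V => P.elt t.2.1 fun j => Sum.elim id (fun _ => 0) (t.2.2 j))
    (eq_of_plugs_inl h')
  exact this.symm

/-- The element `(μ(ν₁, …, νₖ); v₁₁, …, vₖₙₖ)`. -/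
noncomputable def total {k : ℕ} (μ : P.obj k) (x : Fin k → P.Labelled V) : P.Schur V :=
  P.elt (P.comp μ fun j => (x j).2.1) fun s =>
    (x (finSigmaFinEquiv.symm s).1).2.2 (finSigmaFinEquiv.symm s).2

theorem evals_total {k : ℕ} (μ : P.obj k) (x : Fin k → P.Labelled V) :
    Evals ⟨k, μ, fun j => .inr (x j)⟩ (total μ x) :=
  ⟨_, _, _, comp_plugs μ x, rfl⟩

theorem total_act {k : ℕ} (σ : Equiv.Perm (Fin k)) (μ : P.obj k) (x : Fin k → P.Labelled V) :
    total (P.act σ μ) x = total μ (x ∘ ⇑σ⁻¹) :=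
  ((evals_total (P.act σ μ) x).permRel (.perm σ μ _)).unique (evals_total μ (x ∘ ⇑σ⁻¹))

theorem insertAt_update {B : Type*} {m n p : ℕ} (i : Fin m) (h : p + 1 = m + n) (u : Fin m → B)
    (b : B) (w : Fin n → B) : insertAt i h (Function.update u i b) w = insertAt i h u w := by
  funext s
  obtain ⟨⟨j, hj⟩ | k, rfl⟩ := (block i h).surjective s <;> simp [insertAt_block, *]

theorem plugs_update {V : Type u} {k n p : ℕ} (j : Fin k) (h : p + 1 = k + n) (μ : P.obj k) (ν : P.obj n)
    (w : Fin n → V) (x : Fin k → P.Labelled V) :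
    Relation.ReflTransGen Plug
      ⟨k, μ, fun i => .inr (Function.update x j ⟨n, ν, w⟩ i)⟩
      ⟨p, P.circ j h μ ν, insertAt j h (fun i => .inr (x i)) fun i => .inl (w i)⟩ := by
  have key := Plug.plug (P := P) j h μ ν (fun i => .inr (Function.update x j ⟨n, ν, w⟩ i)) w
    (by simp)
  have : (fun i => Sum.inr (Function.update x j ⟨n, ν, w⟩ i) : Fin k → V ⊕ P.Labelled V)
      = Function.update (fun i => .inr (x i)) j (.inr ⟨n, ν, w⟩) := by
    funext i
    by_cases hi : i = j
    · subst hi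
      simp
    · simp [hi]
  rw [this, insertAt_update] at key
  rw [this]
  exact .single key

/-- Since the order of plugging is immaterial, input `j` may be filled first. Inner equivariance
then turns `σ` into a permutation of the composite, which does not affect the value. -/
theorem total_update_act {k n : ℕ} (j : Fin k) (σ : Equiv.Perm (Fin n)) (μ : P.obj k)
    (ν : P.obj n) (w : Fin n → V) (x : Fin k → P.Labelled V) :
    total μ (Function.update x j ⟨n, P.act σ ν, w⟩)
      = total μ (Function.update x j ⟨n, ν, w ∘ ⇑σ⁻¹⟩) := by
  obtain ⟨p, h⟩ : ∃ p, p + 1 = k + n := ⟨k + n - 1, by have := j.2; omega⟩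
  have h₁ := (evals_total μ (Function.update x j ⟨n, P.act σ ν, w⟩)).plugs
    (plugs_update j h μ (P.act σ ν) w x)
  have h₂ := (evals_total μ (Function.update x j ⟨n, ν, w ∘ ⇑σ⁻¹⟩)).plugs
    (plugs_update j h μ ν (w ∘ ⇑σ⁻¹) x)
  rw [P.circ_act] at h₁
  refine (h₁.permRel (.perm _ _ _)).unique ?_
  rw [insertAt_comp_innerPerm]
  exact h₂

theorem compAux_linear (k : ℕ) {p q : ℕ} (n : Fin k → ℕ) (hk : k ≤ p) (h : q + k = p + ∑ j, n j)
    (ν : ∀ j, P.obj (n j)) :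
    ∃ L : P.obj p →ₗ[R] P.obj q, ∀ μ, P.compAux k n hk h μ ν = L μ := by
  induction k generalizing p with
  | zero =>
    obtain rfl : p = q := by simp at h; omega
    exact ⟨LinearMap.id, fun _ => rfl⟩
  | succ k ih =>
    have hsum := Fin.sum_univ_castSucc n
    obtain ⟨L, hL⟩ := ih (p := p + n (Fin.last k) - 1) (fun j => n j.castSucc) (by omega)
      (by omega) fun j => ν j.castSucc
    exact ⟨L ∘ₗ (P.circ ⟨k, hk⟩ (by omega)).flip (ν (Fin.last k)), fun μ => hL _⟩

theorem compAux_linear_inner (k : ℕ) {p q : ℕ} (n : Fin k → ℕ) (hk : k ≤ p)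
    (h : q + k = p + ∑ j, n j) (μ : P.obj p) (ν : ∀ j, P.obj (n j)) (j : Fin k) :
    ∃ L : P.obj (n j) →ₗ[R] P.obj q, ∀ a,
      P.compAux k n hk h μ (Function.update ν j a) = L a := by
  induction k generalizing p with
  | zero => exact j.elim0
  | succ k ih =>
    have hsum := Fin.sum_univ_castSucc n
    induction j using Fin.lastCases with
    | last =>
      obtain ⟨L, hL⟩ := compAux_linear (P := P) k (p := p + n (Fin.last k) - 1) (q := q)
        (fun j => n j.castSucc) (by omega) (by omega) fun j => ν j.castSucc
      refine ⟨L ∘ₗ P.circ ⟨k, hk⟩ (by omega) μ, fun a => ?_⟩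
      rw [LinearMap.comp_apply, ← hL, compAux, Function.update_self]
      congr 1
      funext i
      rw [Function.update_of_ne (Fin.castSucc_lt_last i).ne]
    | cast j =>
      obtain ⟨L, hL⟩ := ih (p := p + n (Fin.last k) - 1) (fun j => n j.castSucc) (by omega)
        (by omega) (P.circ ⟨k, hk⟩ (by omega) μ (ν (Fin.last k))) (fun j => ν j.castSucc) j
      refine ⟨L, fun a => ?_⟩
      rw [← hL, compAux, Function.update_of_ne (Fin.castSucc_lt_last j).ne']
      congr 1
      funext i
      by_cases hi : i = j
      · subst hi
        simp
      · rw [Function.update_of_ne hi, Function.update_of_ne (by simpa using hi)]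

theorem update_sigmaEquiv {B ι S : Type*} [DecidableEq ι] [DecidableEq S] {n : ι → ℕ}
    (e : (Σ i, Fin (n i)) ≃ S) (w : ∀ i, Fin (n i) → B) (j : ι) (t : Fin (n j)) (a : B) :
    (fun s => Function.update w j (Function.update (w j) t a) (e.symm s).1 (e.symm s).2)
      = Function.update (fun s => w (e.symm s).1 (e.symm s).2) (e ⟨j, t⟩) a := by
  funext s
  obtain ⟨⟨i, r⟩, rfl⟩ := e.surjective s
  by_cases hi : i = j
  · subst hi
    by_cases hr : r = t
    · subst hr
      rw [Equiv.symm_apply_apply]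
      simp
    · rw [Function.update_of_ne (a := e ⟨i, r⟩) (fun h => hr (by simpa using e.injective h)),
        Equiv.symm_apply_apply]
      simp [hr]
  · rw [Function.update_of_ne (a := e ⟨i, r⟩)
      (fun h => hi (congrArg Sigma.fst (e.injective h))), Equiv.symm_apply_apply]
    simp [hi]

theorem total_update_linear {k : ℕ} (μ : P.obj k) (x : Fin k → P.Labelled V) (j : Fin k) (n : ℕ) :
    ∃ f : P.obj n →ₗ[R] MultilinearMap R (fun _ : Fin n => V) (P.Schur V), ∀ ν w,
      total μ (Function.update x j ⟨n, ν, w⟩) = f ν w := by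
  -- Once slot `j` holds a dummy label of arity `n`, updating it changes no arity, so all composites
  -- lie in one module of operations.
  suffices H : ∀ y : Fin k → P.Labelled V,
      ∃ f : P.obj (y j).1 →ₗ[R] MultilinearMap R (fun _ : Fin (y j).1 => V) (P.Schur V), ∀ ν w,
        total μ (Function.update y j ⟨(y j).1, ν, w⟩) = f ν w by
    obtain ⟨f, hf⟩ := H (Function.update x j ⟨n, 0, fun _ => 0⟩)
    simp only [Function.update_idem] at hf
    have hn : (Function.update x j (⟨n, 0, fun _ => 0⟩ : P.Labelled V) j).1 = n := by simp
    revert f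
    rw [hn]
    exact fun f hf => ⟨f, hf⟩
  intro y
  obtain ⟨L, hL⟩ := P.compAux_linear_inner k (fun j => (y j).1) le_rfl
    (add_comm _ k) μ (fun j => (y j).2.1) j
  have hup : ∀ (ν : P.obj (y j).1) (w : Fin (y j).1 → V),
      Function.update y j ⟨(y j).1, ν, w⟩ = fun i => (⟨(y i).1, Function.update
        (fun i => (y i).2.1) j ν i, Function.update (fun i => (y i).2.2) j w i⟩ : P.Labelled V) := by
    intro ν w
    funext i
    by_cases hi : i = j
    · subst hi
      simp
    · simp [hi]
  -- The concatenated labels. One entry of `w` is one entry of `c w`, so multilinearity is inherited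
  -- from `elt`.
  let c (w : Fin (y j).1 → V) (s : Fin (∑ i, (y i).1)) : V :=
    Function.update (fun i => (y i).2.2) j w (finSigmaFinEquiv.symm s).1
      (finSigmaFinEquiv.symm s).2
  have hc : ∀ w t a, c (Function.update w t a)
      = Function.update (c w) (finSigmaFinEquiv ⟨j, t⟩) a := by
    intro w t a
    have := update_sigmaEquiv finSigmaFinEquiv (Function.update (fun i => (y i).2.2) j w) j t a
    rw [Function.update_idem, Function.update_self] at this
    exact this
  refine ⟨⟨⟨fun ν => MultilinearMap.mk' (fun w => P.eltHom V _ (L ν) (c w))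
    (fun w t a b => ?_) (fun w t b a => ?_), fun ν ν' => ?_⟩, fun b ν => ?_⟩, fun ν w => ?_⟩
  · simp only [hc, MultilinearMap.map_update_add]
  · simp only [hc, MultilinearMap.map_update_smul]
  · ext w
    simp
  · ext w
    simp
  · exact (congrArg (total μ) (hup ν w)).trans
      (congrArg (fun o => P.elt o (c w)) (hL ν))

theorem total_update (P : Operad R) {k : ℕ} (μ : P.obj k) (x : Fin k → P.Labelled V) (j : Fin k) :
    ∃ L : P.Schur V →ₗ[R] P.Schur V, ∀ a, total μ (Function.update x j a) = L (P.gen V a) := by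
  choose f hf using total_update_linear μ x j
  refine ⟨schurLift f fun n σ ν w => ?_, fun ⟨n, ν, w⟩ => ?_⟩
  · rw [← hf, ← hf, total_update_act]
  · rw [gen, schurLift_elt, hf]

variable (P V) in
/-- The action of the operations on `S(P, V)`, which is the free algebra on `V`. -/
noncomputable def algMap (k : ℕ) :
    P.obj k →ₗ[R] MultilinearMap R (fun _ : Fin k => P.Schur V) (P.Schur V) :=
  have h (μ : P.obj k) := exists_multilinearMap_of_span_eq_top (P.span_range_gen V) k (total μ)
    fun x j => P.total_update μ x j
  { toFun μ := (h μ).choose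
    map_add' μ ν := by
      refine MultilinearMap.ext_of_span_eq_top (fun _ => P.span_range_gen V) fun x => ?_
      obtain ⟨L, hL⟩ := P.compAux_linear k (fun j => (x j).1) le_rfl (add_comm _ k)
        fun j => (x j).2.1
      rw [add_apply, (h _).choose_spec, (h _).choose_spec, (h _).choose_spec]
      simp only [total, comp, hL, map_add, ← eltHom_apply, add_apply]
    map_smul' c μ := by
      refine MultilinearMap.ext_of_span_eq_top (fun _ => P.span_range_gen V) fun x => ?_
      obtain ⟨L, hL⟩ := P.compAux_linear k (fun j => (x j).1) le_rfl (add_comm _ k)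
        fun j => (x j).2.1
      rw [smul_apply, (h _).choose_spec, (h _).choose_spec]
      simp only [total, comp, hL, map_smul, ← eltHom_apply, smul_apply,
        RingHom.id_apply] }

theorem algMap_gen {k : ℕ} (μ : P.obj k) (x : Fin k → P.Labelled V) :
    P.algMap V k μ (fun j => P.gen V (x j)) = total μ x :=
  (exists_multilinearMap_of_span_eq_top (P.span_range_gen V) k (total μ)
    fun x j => P.total_update μ x j).choose_spec x

theorem algMap_act {k : ℕ} (σ : Equiv.Perm (Fin k)) (μ : P.obj k) (z : Fin k → P.Schur V) :
    P.algMap V k (P.act σ μ) z = P.algMap V k μ (z ∘ ⇑σ⁻¹) := by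
  have : P.algMap V k (P.act σ μ) = (P.algMap V k μ).domDomCongr σ⁻¹ := by
    refine MultilinearMap.ext_of_span_eq_top (fun _ => P.span_range_gen V) fun x => ?_
    rw [algMap_gen, total_act, MultilinearMap.domDomCongr_apply, ← algMap_gen]
    rfl
  rw [this]
  rfl

variable (P V) in
/-- The multiplication of the monad. -/
noncomputable def mulMap : P.Schur (P.Schur V) →ₗ[R] P.Schur V :=
  schurLift (P.algMap V) fun _ => algMap_act

theorem mulMap_elt {k : ℕ} (μ : P.obj k) (z : Fin k → P.Schur V) :
    P.mulMap V (P.elt μ z) = P.algMap V k μ z :=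
  schurLift_elt _ _ _ _

/-- Both sides are linear in each label, so generators suffice; there they are values of two terms
with a common reduct. -/
theorem algMap_circ {m n p : ℕ} (i : Fin m) (h : p + 1 = m + n) (μ : P.obj m) (ν : P.obj n)
    (u : Fin m → P.Schur V) (w : Fin n → P.Schur V) :
    P.algMap V p (P.circ i h μ ν) (insertAt i h u w)
      = P.algMap V m μ (Function.update u i (P.algMap V n ν w)) := by
  -- The right-hand side as a function of one tuple indexed by the inputs of the composite.
  let G (z : Fin p → P.Schur V) : P.Schur V := P.algMap V m μ (fun j => if hj : j = i then
    P.algMap V n ν fun k => z (block i h (.inr k)) else z (block i h (.inl ⟨j, hj⟩)))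
  have hG : SeparatelyLinear R G := by
    intro z s
    obtain ⟨⟨j, hj⟩ | k, rfl⟩ := (block i h).surjective s
    · refine ⟨(P.algMap V m μ).toLinearMap (fun j => if hj : j = i then
        P.algMap V n ν fun k => z (block i h (.inr k)) else z (block i h (.inl ⟨j, hj⟩))) j,
        fun a => ?_⟩
      simp only [MultilinearMap.toLinearMap_apply, G]
      congr 1
      funext j'
      by_cases hj' : j' = j
      · subst hj'
        simp [hj]
      · by_cases hi : j' = i
        · subst hi
          simp [hj']
        · simp [hj', hi]
    · refine ⟨(P.algMap V m μ).toLinearMap (fun j => if hj : j = i then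
        0 else z (block i h (.inl ⟨j, hj⟩))) i ∘ₗ
          (P.algMap V n ν).toLinearMap (fun k => z (block i h (.inr k))) k, fun a => ?_⟩
      simp only [MultilinearMap.toLinearMap_apply, LinearMap.comp_apply, G]
      congr 1
      funext j'
      by_cases hi : j' = i
      · subst hi
        simp only [dite_true, Function.update_self]
        congr 1
        funext k'
        by_cases hk : k' = k
        · subst hk
          simp
        · simp [hk]
      · simp [hi]
  have hFG : ⇑(P.algMap V p (P.circ i h μ ν)) = G := by
    refine (MultilinearMap.separatelyLinear _).eq_of_span_eq_top hG (P.span_range_gen V)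
      fun x => ?_
    let x' (k : Fin n) : P.Labelled V := x (block i h (.inr k))
    let u' (j : Fin m) : P.Labelled V := if hj : j = i then
      ⟨_, P.comp ν fun j => (x' j).2.1, fun s =>
        (x' (finSigmaFinEquiv.symm s).1).2.2 (finSigmaFinEquiv.symm s).2⟩
      else x (block i h (.inl ⟨j, hj⟩))
    have h₁ : G (fun s => P.gen V (x s)) = total μ u' := by
      rw [← algMap_gen]
      simp only [G]
      congr 1
      funext j
      by_cases hj : j = i
      · subst hj
        simp only [u', dite_true]
        exact algMap_gen ν x'
      · simp [u', hj]
    rw [h₁, algMap_gen]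
    have hx : (fun s => .inr (x s) : Fin p → V ⊕ P.Labelled V)
        = insertAt i h (fun j => .inr (u' j)) fun k => .inr (x' k) := by
      funext s
      obtain ⟨⟨j, hj⟩ | k, rfl⟩ := (block i h).surjective s
      · simp [insertAt_block, u', hj]
      · simp [insertAt_block, x']
    have h₂ := evals_total (P.circ i h μ ν) x
    rw [hx] at h₂
    obtain ⟨q, hq⟩ : ∃ q, q + 1 = m + ∑ j, (x' j).1 :=
      ⟨m + ∑ j, (x' j).1 - 1, by have := i.2; omega⟩
    -- Filling all inputs of ν inside μ ∘ᵢ ν reaches the same term as plugging ν(x') into input `i`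
    -- of μ.
    have h₃ := h₂.plugs (plugs_circ (comp_plugs ν x') i h hq μ _)
    exact h₃.unique ((evals_total μ u').plugs (.single (.plug i hq μ _ _ _ (by simp [u']))))
  rw [hFG]
  simp only [G]
  congr 1
  funext j
  by_cases hj : j = i
  · subst hj
    simp [insertAt_block]
  · simp [hj, insertAt_block]

/-- The action of an operation on `S(P, V)`, of a term with labels in `S(P, V)`, does not change
when a label is plugged in. -/
theorem algMap_plugs {t t' : P.Term (P.Schur V)} (h : Relation.ReflTransGen Plug t t') :
    P.algMap V t.1 t.2.1 (fun j => Sum.elim id (fun x => P.mulMap V (P.gen _ x)) (t.2.2 j))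
      = P.algMap V t'.1 t'.2.1
        (fun j => Sum.elim id (fun x => P.mulMap V (P.gen _ x)) (t'.2.2 j)) := by
  induction h with
  | refl => rfl
  | tail _ hbc ih =>
    rw [ih]
    obtain ⟨i, h, μ, ν, u, w, hu⟩ := hbc
    simp only
    rw [insertAt_comp i h u _ (Sum.elim id fun x => P.mulMap V (P.gen _ x)), algMap_circ]
    congr 1
    symm
    rw [Function.update_eq_self_iff]
    simp only [hu, Sum.elim_inl, Sum.elim_inr, id, gen, mulMap_elt]

theorem mulMap_elt_elt {k : ℕ} {n : Fin k → ℕ} (μ : P.obj k) (ν : ∀ j, P.obj (n j))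
    (v : ∀ j, Fin (n j) → V) :
    P.mulMap V (P.elt μ fun j => P.elt (ν j) (v j)) =
      P.elt (P.comp μ ν) fun i => v (finSigmaFinEquiv.symm i).1 (finSigmaFinEquiv.symm i).2 := by
  rw [mulMap_elt]
  exact algMap_gen μ fun j => ⟨n j, ν j, v j⟩

/-- Linear maps on `S(P, S(P, V))` are determined by their values on the elements
`(μ; (ν₁; v₁₁, …), …, (νₖ; vₖ₁, …))`. -/
theorem schur_schur_hom_ext {N : Type u} [AddCommGroup N] [Module R N]
    {f g : P.Schur (P.Schur V) →ₗ[R] N}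
    (h : ∀ (k : ℕ) (μ : P.obj k) (x : Fin k → P.Labelled V),
      f (P.elt μ fun j => P.gen V (x j)) = g (P.elt μ fun j => P.gen V (x j))) : f = g := by
  refine P.schur_hom_ext fun k μ z => ?_
  have : f.compMultilinearMap (P.eltHom _ k μ) = g.compMultilinearMap (P.eltHom _ k μ) :=
    MultilinearMap.ext_of_span_eq_top (fun _ => P.span_range_gen V) fun x => h k μ x
  exact DFunLike.congr_fun this z

/-- A term with labels in S(P, V) can have its operation labels evaluated at once, or plugged in
first. These are the two sides, and `algMap_plugs` along the reduction `comp_plugs` identifies them.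
-/
theorem mulMap_assoc (s : P.Schur (P.Schur (P.Schur V))) :
    P.mulMap V (P.schurMap (P.mulMap V) s) = P.mulMap V (P.mulMap (P.Schur V) s) := by
  have : P.mulMap V ∘ₗ P.schurMap (P.mulMap V) = P.mulMap V ∘ₗ P.mulMap (P.Schur V) := by
    refine schur_schur_hom_ext fun k μ x => ?_
    have h₁ : P.mulMap V (P.schurMap (P.mulMap V) (P.elt μ fun j => P.gen _ (x j)))
        = P.algMap V k μ fun j => P.mulMap V (P.gen _ (x j)) := by
      rw [schurMap_elt]
      exact mulMap_elt _ _
    have h₂ : P.mulMap (P.Schur V) (P.elt μ fun j => P.gen _ (x j)) = total μ x :=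
      (mulMap_elt _ _).trans (algMap_gen μ x)
    have h₃ : P.mulMap V (total μ x) = P.algMap V _ (P.comp μ fun j => (x j).2.1) fun s =>
        (x (finSigmaFinEquiv.symm s).1).2.2 (finSigmaFinEquiv.symm s).2 :=
      mulMap_elt (P.comp μ fun j => (x j).2.1) _
    have h₄ := algMap_plugs (comp_plugs μ x)
    simp only [Sum.elim_inl, Sum.elim_inr, id] at h₄
    exact h₁.trans (h₄.trans (h₃.symm.trans (congrArg (P.mulMap V) h₂.symm)))
  exact LinearMap.congr_fun this s

variable (P V) in
/-- The unit of the monad. -/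
noncomputable def unitMap : V →ₗ[R] P.Schur V :=
  DirectSum.lof R ℕ (fun n => (P.diagRep n V).Coinvariants) 1 ∘ₗ
    Representation.Coinvariants.mk (P.diagRep 1 V) ∘ₗ
      TensorProduct.mk R _ _ P.one ∘ₗ 
        (PiTensorProduct.subsingletonEquiv (R := R) (s := fun _ => V) (0 : Fin 1)).symm.toLinearMap

theorem unitMap_apply (v : V) : P.unitMap V v = P.elt P.one fun _ => v := by
  simp [unitMap, elt]

theorem insertAt_one {B : Type*} {n : ℕ} (h : n + 1 = 1 + n) (u : Fin 1 → B) (w : Fin n → B) :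
    insertAt 0 h u w = w :=
  funext fun s => insertAt_apply_inside _ _ _ _ s _ (by simp)

theorem mulMap_unitMap (s : P.Schur V) : P.mulMap V (P.unitMap (P.Schur V) s) = s := by
  have : P.mulMap V ∘ₗ P.unitMap (P.Schur V) = LinearMap.id := by
    refine P.schur_hom_ext fun n ν w => ?_
    rw [LinearMap.comp_apply, unitMap_apply, mulMap_elt]
    refine (algMap_gen P.one fun _ => ⟨n, ν, w⟩).trans (((evals_total P.one _).plugs
      (.single (.plug 0 (add_comm n 1) P.one ν _ w rfl))).unique ⟨n, ν, w, ?_, rfl⟩)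
    rw [P.one_circ, insertAt_one]
  exact LinearMap.congr_fun this s

/-- Plugging in the unit changes neither the operation nor the places of the inputs; the induction
is over the set of inputs already filled. -/
theorem plugs_one {A : Type u} {k : ℕ} (μ : P.obj k) (v : Fin k → A) :
    Relation.ReflTransGen (Plug (P := P)) ⟨k, μ, fun j => .inr ⟨1, P.one, fun _ => v j⟩⟩
      ⟨k, μ, fun j => .inl (v j)⟩ := by
  have key : ∀ s : Finset (Fin k), Relation.ReflTransGen (Plug (P := P))
      ⟨k, μ, fun j => .inr ⟨1, P.one, fun _ => v j⟩⟩
      ⟨k, μ, fun j => if j ∈ s then .inl (v j) else .inr ⟨1, P.one, fun _ => v j⟩⟩ := by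
    intro s
    induction s using Finset.induction_on with
    | empty => simpa using .refl
    | insert i s hi ih =>
      refine ih.tail ?_
      have h := Plug.plug (P := P) (p := k) (n := 1) i rfl μ P.one
        (fun j => if j ∈ s then .inl (v j) else .inr ⟨1, P.one, fun _ => v j⟩)
        (fun _ => v i) (by simp [hi])
      rw [P.circ_one] at h
      convert h using 3
      funext j
      rcases lt_trichotomy j i with hj | rfl | hj
      · rw [insertAt_apply_before i j _ _ _ hj _ rfl]
        simp [hj.ne]
      · rw [insertAt_apply_inside j _ _ _ 0 _ (by simp)]
        simp
      · rw [insertAt_apply_after i j _ _ _ hj _ rfl]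
        simp [hj.ne']
  simpa using key Finset.univ

theorem algMap_one {k : ℕ} (μ : P.obj k) (v : Fin k → V) :
    P.algMap V k μ (fun j => P.elt P.one fun _ => v j) = P.elt μ v := by
  have h := algMap_gen μ fun j => (⟨1, P.one, fun _ => v j⟩ : P.Labelled V)
  exact h.trans (((evals_total μ _).plugs (plugs_one μ v)).unique ⟨k, μ, v, .refl, rfl⟩)

end Multiplication

end Operad

/-! ### The monad and directional derivatives on S(P, V) -/

namespace Operad

section Derivative

variable {R : Type u} [CommRing R] {P : Operad R} {V W X : Type u} [AddCommGroup V] [Module R V]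
  [AddCommGroup W] [Module R W] [AddCommGroup X] [Module R X]

theorem unitMap_naturality (f : V →ₗ[R] W) (v : V) :
    P.unitMap W (f v) = P.schurMap f (P.unitMap V v) := by
  rw [unitMap_apply, unitMap_apply, schurMap_elt]

theorem mulMap_naturality (f : V →ₗ[R] W) (s : P.Schur (P.Schur V)) :
    P.mulMap W (P.schurMap (P.schurMap f) s) = P.schurMap f (P.mulMap V s) := by
  have : P.mulMap W ∘ₗ P.schurMap (P.schurMap f) = P.schurMap f ∘ₗ P.mulMap V := by
    refine schur_schur_hom_ext fun k μ x => ?_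
    simp only [LinearMap.comp_apply, schurMap_elt, gen, mulMap_elt_elt]
  exact LinearMap.congr_fun this s

theorem mulMap_schurMap_unitMap (s : P.Schur V) :
    P.mulMap V (P.schurMap (P.unitMap V) s) = s := by
  have : P.mulMap V ∘ₗ P.schurMap (P.unitMap V) = LinearMap.id := by
    refine P.schur_hom_ext fun n μ v => ?_
    simp only [LinearMap.comp_apply, schurMap_elt, unitMap_apply, LinearMap.id_apply]
    exact (mulMap_elt _ _).trans (algMap_one μ v)
  exact LinearMap.congr_fun this s

variable (P) in
/-- The monad associated to an operad. -/
noncomputable def associatedMonad : P.AssociatedMonad where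
  η :=
    { app V := ModuleCat.ofHom (P.unitMap V)
      naturality _ _ f := ModuleCat.hom_ext (LinearMap.ext fun v => unitMap_naturality f.hom v) }
  γ :=
    { app V := ModuleCat.ofHom (P.mulMap V)
      naturality _ _ f := ModuleCat.hom_ext (LinearMap.ext fun v => mulMap_naturality f.hom v) }
  η_apply _ v := unitMap_apply v
  γ_apply _ _ _ μ ν v := mulMap_elt_elt μ ν v
  assoc _ := ModuleCat.hom_ext (LinearMap.ext fun s => mulMap_assoc s)
  left_unit _ := ModuleCat.hom_ext (LinearMap.ext fun s => mulMap_unitMap s)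
  right_unit _ := ModuleCat.hom_ext (LinearMap.ext fun s => mulMap_schurMap_unitMap s)

/-- The linear map with
`(μ; v₁, …, vₙ) ↦ ∑ i, (μ; f v₁, …, g vᵢ, …, f vₙ)`. -/
noncomputable def dirDeriv (f g : V →ₗ[R] W) : P.Schur V →ₗ[R] P.Schur W :=
  schurLift (fun n => ∑ i : Fin n, MultilinearMap.compLinearMapₗ
      (fun j => if j = i then g else f) ∘ₗ P.eltHom W n) (by
    intro n σ μ v
    simp only [LinearMap.sum_apply, _root_.sum_apply, LinearMap.comp_apply,
      MultilinearMap.compLinearMapₗ_apply, MultilinearMap.compLinearMap_apply, eltHom_apply,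
      elt_act]
    -- The distinguished input `i` of μ · σ is input `σ i` of μ.
    refine Fintype.sum_equiv σ _ _ fun i => ?_
    congr 1
    funext j
    simp only [Function.comp_apply, Equiv.Perm.inv_eq_iff_eq])

theorem dirDeriv_elt (f g : V →ₗ[R] W) {n : ℕ} (μ : P.obj n) (v : Fin n → V) :
    dirDeriv f g (P.elt μ v)
      = ∑ i : Fin n, P.elt μ (fun j => if j = i then g (v j) else f (v j)) := by
  rw [dirDeriv, schurLift_elt]
  simp only [LinearMap.sum_apply, _root_.sum_apply, LinearMap.comp_apply,
    MultilinearMap.compLinearMapₗ_apply, MultilinearMap.compLinearMap_apply, eltHom_apply]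
  refine Finset.sum_congr rfl fun i _ => ?_
  congr 1
  funext j
  split_ifs <;> rfl

theorem elt_eq_zero {n : ℕ} (μ : P.obj n) (v : Fin n → V) (i : Fin n) (h : v i = 0) :
    P.elt μ v = 0 :=
  (P.eltHom V n μ).map_coord_zero i h

theorem schurMap_dirDeriv (h : W →ₗ[R] X) (f g : V →ₗ[R] W) (s : P.Schur V) :
    P.schurMap h (dirDeriv f g s) = dirDeriv (h ∘ₗ f) (h ∘ₗ g) s := by
  have : P.schurMap h ∘ₗ dirDeriv f g = dirDeriv (h ∘ₗ f) (h ∘ₗ g) := by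
    refine P.schur_hom_ext fun n μ v => ?_
    simp only [LinearMap.comp_apply, dirDeriv_elt, map_sum, schurMap_elt, apply_ite h]
  exact LinearMap.congr_fun this s

theorem dirDeriv_schurMap (h : V →ₗ[R] W) (f g : W →ₗ[R] X) (s : P.Schur V) :
    dirDeriv f g (P.schurMap h s) = dirDeriv (f ∘ₗ h) (g ∘ₗ h) s := by
  have : dirDeriv f g ∘ₗ P.schurMap h = dirDeriv (f ∘ₗ h) (g ∘ₗ h) := by
    refine P.schur_hom_ext fun n μ v => ?_
    simp only [LinearMap.comp_apply, dirDeriv_elt, schurMap_elt]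
  exact LinearMap.congr_fun this s

theorem dirDeriv_zero (f : V →ₗ[R] W) (s : P.Schur V) : dirDeriv f 0 s = 0 := by
  have : (dirDeriv f 0 : P.Schur V →ₗ[R] P.Schur W) = 0 := by
    refine P.schur_hom_ext fun n μ v => ?_
    rw [dirDeriv_elt, LinearMap.zero_apply]
    exact Finset.sum_eq_zero fun i _ => elt_eq_zero μ _ i (by simp)
  rw [this, LinearMap.zero_apply]

theorem dirDeriv_add (f g g' : V →ₗ[R] W) (s : P.Schur V) :
    dirDeriv f (g + g') s = dirDeriv f g s + dirDeriv f g' s := by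
  have : (dirDeriv f (g + g') : P.Schur V →ₗ[R] P.Schur W) = dirDeriv f g + dirDeriv f g' := by
    refine P.schur_hom_ext fun n μ v => ?_
    rw [LinearMap.add_apply, dirDeriv_elt, dirDeriv_elt, dirDeriv_elt, ← Finset.sum_add_distrib]
    refine Finset.sum_congr rfl fun i _ => ?_
    have key (l : V →ₗ[R] W) : (fun j => if j = i then l (v j) else f (v j))
        = Function.update (fun j => f (v j)) i (l (v i)) := by
      funext j
      by_cases hj : j = i
      · subst hj
        simp
      · simp [hj]
    rw [key, key, key]
    exact (P.eltHom W n μ).map_update_add _ i _ _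
  rw [this, LinearMap.add_apply]

theorem dirDeriv_unitMap (f g : V →ₗ[R] W) (v : V) :
    dirDeriv f g (P.unitMap V v) = P.unitMap W (g v) := by
  rw [unitMap_apply, unitMap_apply, dirDeriv_elt, Fin.sum_univ_one]
  congr 1
  funext j
  rw [if_pos (Subsingleton.elim _ _)]

/-- Leibniz rule: choosing an input of μ(ν₁, …, νₖ) is choosing a slot `j` of μ and then an input
`t` of νⱼ; the slots other than `j` only undergo `f`. -/
theorem dirDeriv_mulMap (f g : V →ₗ[R] W) (s : P.Schur (P.Schur V)) :
    dirDeriv f g (P.mulMap V s) = P.mulMap W (dirDeriv (P.schurMap f) (dirDeriv f g) s) := by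
  have : dirDeriv f g ∘ₗ P.mulMap V
      = P.mulMap W ∘ₗ dirDeriv (P.schurMap f) (dirDeriv f g) := by
    refine schur_schur_hom_ext fun k μ x => ?_
    rw [LinearMap.comp_apply, LinearMap.comp_apply]
    have hL : P.mulMap V (P.elt μ fun j => P.gen V (x j)) = _ :=
      mulMap_elt_elt μ (fun j => (x j).2.1) fun j => (x j).2.2
    rw [hL, dirDeriv_elt, dirDeriv_elt, map_sum,
      ← finSigmaFinEquiv.sum_comp, Fintype.sum_sigma]
    refine Finset.sum_congr rfl fun j _ => ?_
    have h₁ : (fun i => if i = j then dirDeriv f g (P.gen V (x i))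
        else P.schurMap f (P.gen V (x i)))
        = Function.update (fun i => P.schurMap f (P.gen V (x i))) j
          (∑ t, P.elt (x j).2.1 fun r => if r = t then g ((x j).2.2 r) else f ((x j).2.2 r)) := by
      funext i
      by_cases hi : i = j
      · subst hi
        rw [if_pos rfl, Function.update_self, gen, dirDeriv_elt]
      · rw [if_neg hi, Function.update_of_ne hi]
    rw [h₁, mulMap_elt, MultilinearMap.map_update_sum]
    refine Finset.sum_congr rfl fun t _ => ?_
    have h₂ : Function.update (fun i => P.schurMap f (P.gen V (x i))) j
          (P.elt (x j).2.1 fun r => if r = t then g ((x j).2.2 r) else f ((x j).2.2 r))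
        = fun i => P.elt (x i).2.1 fun r =>
          if (⟨i, r⟩ : Σ i, Fin (x i).1) = ⟨j, t⟩ then g ((x i).2.2 r) else f ((x i).2.2 r) := by
      funext i
      by_cases hi : i = j
      · subst hi
        rw [Function.update_self]
        simp
      · rw [Function.update_of_ne hi, gen, schurMap_elt]
        simp [hi]
    rw [h₂, ← mulMap_elt, mulMap_elt_elt]
    congr 1
    funext s
    simp only [Sigma.eta, Equiv.symm_apply_eq]
  exact LinearMap.congr_fun this s

theorem dirDeriv_dirDeriv_elt (f g : W →ₗ[R] X) (f' g' : V →ₗ[R] W) {n : ℕ} (μ : P.obj n)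
    (v : Fin n → V) :
    dirDeriv f g (dirDeriv f' g' (P.elt μ v)) = ∑ i : Fin n, ∑ j : Fin n, P.elt μ fun k =>
      if k = j then if k = i then g (g' (v k)) else g (f' (v k))
      else if k = i then f (g' (v k)) else f (f' (v k)) := by
  simp only [dirDeriv_elt, map_sum, apply_ite f, apply_ite g]

theorem dirDeriv_dirDeriv_diag (F G : W →ₗ[R] X) (f g : V →ₗ[R] W) (h : G ∘ₗ f = 0)
    (s : P.Schur V) :
    dirDeriv F G (dirDeriv f g s) = dirDeriv (F ∘ₗ f) (G ∘ₗ g) s := by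
  have : dirDeriv F G ∘ₗ dirDeriv f g
      = (dirDeriv (F ∘ₗ f) (G ∘ₗ g) : P.Schur V →ₗ[R] P.Schur X) := by
    refine P.schur_hom_ext fun n μ v => ?_
    rw [LinearMap.comp_apply, dirDeriv_dirDeriv_elt, dirDeriv_elt]
    refine Finset.sum_congr rfl fun i _ => ?_
    rw [Finset.sum_eq_single i]
    · congr 1
      funext k
      by_cases hk : k = i <;> simp [hk]
    -- Off the diagonal, slot `j` receives `G ∘ f`, which is zero.
    · intro j _ hj
      refine elt_eq_zero μ _ j ?_
      rw [if_pos rfl, if_neg hj]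
      exact LinearMap.congr_fun h _
    · simp
  exact LinearMap.congr_fun this s

/-- Exchanging the two sums exchanges the roles of the slots hit by the first and second derivative.
The hypotheses compare the maps applied in a slot hit by neither, by one, or by both. -/
theorem dirDeriv_dirDeriv_comm (F G F' G' : W →ₗ[R] X) (f g f' g' : V →ₗ[R] W)
    (h₁ : F ∘ₗ f = F' ∘ₗ f') (h₂ : F ∘ₗ g = G' ∘ₗ f') (h₃ : G ∘ₗ f = F' ∘ₗ g')
    (h₄ : G ∘ₗ g = G' ∘ₗ g') (s : P.Schur V) :
    dirDeriv F G (dirDeriv f g s) = dirDeriv F' G' (dirDeriv f' g' s) := by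
  have : dirDeriv F G ∘ₗ dirDeriv f g
      = (dirDeriv F' G' ∘ₗ dirDeriv f' g' : P.Schur V →ₗ[R] P.Schur X) := by
    refine P.schur_hom_ext fun n μ v => ?_
    rw [LinearMap.comp_apply, LinearMap.comp_apply, dirDeriv_dirDeriv_elt, dirDeriv_dirDeriv_elt,
      Finset.sum_comm]
    refine Finset.sum_congr rfl fun i _ => Finset.sum_congr rfl fun j _ => ?_
    congr 1
    funext k
    have e₁ : F (f (v k)) = F' (f' (v k)) := LinearMap.congr_fun h₁ _
    have e₂ : F (g (v k)) = G' (f' (v k)) := LinearMap.congr_fun h₂ _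
    have e₃ : G (f (v k)) = F' (g' (v k)) := LinearMap.congr_fun h₃ _
    have e₄ : G (g (v k)) = G' (g' (v k)) := LinearMap.congr_fun h₄ _
    split_ifs <;> assumption
  exact LinearMap.congr_fun this s

end Derivative

/-! ### The differential combinator transformation -/

section Differential

variable {R : Type u} [CommRing R] {P : Operad R} {A B D : ModuleCat.{u} R}

/-- `dirDeriv` as a morphism of the category of `R`-modules. -/
noncomputable def deriv (f g : A ⟶ B) : P.schurFunctor.obj A ⟶ P.schurFunctor.obj B :=
  ModuleCat.ofHom (dirDeriv f.hom g.hom)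

theorem deriv_comp_map (f g : A ⟶ B) (h : B ⟶ D) :
    deriv f g ≫ P.schurFunctor.map h = deriv (f ≫ h) (g ≫ h) :=
  ModuleCat.hom_ext (LinearMap.ext fun s => schurMap_dirDeriv h.hom f.hom g.hom s)

theorem map_comp_deriv (h : A ⟶ B) (f g : B ⟶ D) :
    P.schurFunctor.map h ≫ deriv f g = deriv (h ≫ f) (h ≫ g) :=
  ModuleCat.hom_ext (LinearMap.ext fun s => dirDeriv_schurMap h.hom f.hom g.hom s)

theorem deriv_zero (f : A ⟶ B) : (deriv f 0 : P.schurFunctor.obj A ⟶ _) = 0 :=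
  ModuleCat.hom_ext (LinearMap.ext fun s => dirDeriv_zero f.hom s)

theorem deriv_add (f g g' : A ⟶ B) :
    (deriv f (g + g') : P.schurFunctor.obj A ⟶ _) = deriv f g + deriv f g' :=
  ModuleCat.hom_ext (LinearMap.ext fun s => dirDeriv_add f.hom g.hom g'.hom s)

theorem unit_comp_deriv (f g : A ⟶ B) :
    P.associatedMonad.η.app A ≫ deriv f g = g ≫ P.associatedMonad.η.app B :=
  ModuleCat.hom_ext (LinearMap.ext fun v => dirDeriv_unitMap f.hom g.hom v)

theorem mul_comp_deriv (f g : A ⟶ B) :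
    P.associatedMonad.γ.app A ≫ deriv f g
      = deriv (P.schurFunctor.map f) (deriv f g) ≫ P.associatedMonad.γ.app B :=
  ModuleCat.hom_ext (LinearMap.ext fun s => dirDeriv_mulMap f.hom g.hom s)

theorem deriv_comp_deriv_diag (f g : A ⟶ B) (F G : B ⟶ D) (h : f ≫ G = 0) :
    (deriv f g : P.schurFunctor.obj A ⟶ _) ≫ deriv F G = deriv (f ≫ F) (g ≫ G) :=
  ModuleCat.hom_ext (LinearMap.ext fun s => dirDeriv_dirDeriv_diag F.hom G.hom f.hom g.hom
    (congrArg ModuleCat.Hom.hom h) s)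

theorem deriv_comp_deriv_comm (f g f' g' : A ⟶ B) (F G F' G' : B ⟶ D) (h₁ : f ≫ F = f' ≫ F')
    (h₂ : g ≫ F = f' ≫ G') (h₃ : f ≫ G = g' ≫ F') (h₄ : g ≫ G = g' ≫ G') :
    (deriv f g : P.schurFunctor.obj A ⟶ _) ≫ deriv F G = deriv f' g' ≫ deriv F' G' :=
  ModuleCat.hom_ext (LinearMap.ext fun s => dirDeriv_dirDeriv_comm F.hom G.hom F'.hom G'.hom
    f.hom g.hom f'.hom g'.hom (congrArg ModuleCat.Hom.hom h₁) (congrArg ModuleCat.Hom.hom h₂)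
    (congrArg ModuleCat.Hom.hom h₃) (congrArg ModuleCat.Hom.hom h₄) s)

/-- The map under S restricts to S(inl) along `inl` and to ∂ along `inr`, so this is the Leibniz
rule for `inl` and `inr`. -/
theorem mul_comp_deriv_inl_inr (A : ModuleCat.{u} R) :
    P.associatedMonad.γ.app A ≫ deriv (biprod.inl : A ⟶ A ⊞ A) biprod.inr
      = deriv (biprod.inl : P.schurFunctor.obj A ⟶ _) biprod.inr ≫
        P.schurFunctor.map (biprod.fst ≫ P.schurFunctor.map (biprod.lift (𝟙 A) 0 : A ⟶ A ⊞ A) +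
          biprod.snd ≫ deriv (biprod.inl : A ⟶ A ⊞ A) biprod.inr) ≫
        P.associatedMonad.γ.app (A ⊞ A) := by
  have h : (biprod.lift (𝟙 A) 0 : A ⟶ A ⊞ A) = biprod.inl := by
    apply biprod.hom_ext <;> simp
  have h₁ : biprod.inl ≫ (biprod.fst ≫ P.schurFunctor.map (biprod.inl : A ⟶ A ⊞ A) +
      biprod.snd ≫ deriv (biprod.inl : A ⟶ A ⊞ A) biprod.inr)
      = P.schurFunctor.map (biprod.inl : A ⟶ A ⊞ A) := by simp
  have h₂ : biprod.inr ≫ (biprod.fst ≫ P.schurFunctor.map (biprod.inl : A ⟶ A ⊞ A) +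
      biprod.snd ≫ deriv (biprod.inl : A ⟶ A ⊞ A) biprod.inr)
      = deriv (biprod.inl : A ⟶ A ⊞ A) biprod.inr := by simp
  have h₃ := deriv_comp_map (P := P) (biprod.inl : P.schurFunctor.obj A ⟶ _) biprod.inr
    (biprod.fst ≫ P.schurFunctor.map (biprod.inl : A ⟶ A ⊞ A) +
      biprod.snd ≫ deriv (biprod.inl : A ⟶ A ⊞ A) biprod.inr)
  rw [h₁, h₂] at h₃
  rw [h, mul_comp_deriv, ← Category.assoc]
  exact congrArg (· ≫ P.associatedMonad.γ.app (A ⊞ A)) h₃.symm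

/-- The interchange of the middle factors fixes the two pure injections and swaps the two mixed
ones, so symmetry of the second derivative applies. -/
theorem deriv_comp_deriv_inl_inr (A : ModuleCat.{u} R) :
    deriv (P := P) (biprod.inl : A ⟶ A ⊞ A) biprod.inr ≫
      deriv (biprod.inl : A ⊞ A ⟶ (A ⊞ A) ⊞ (A ⊞ A)) biprod.inr ≫
        P.schurFunctor.map
          (biprod.lift (biprod.lift (biprod.fst ≫ biprod.fst) (biprod.snd ≫ biprod.fst))
            (biprod.lift (biprod.fst ≫ biprod.snd) (biprod.snd ≫ biprod.snd)) :
              (A ⊞ A) ⊞ (A ⊞ A) ⟶ (A ⊞ A) ⊞ (A ⊞ A))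
      = deriv (biprod.inl : A ⟶ A ⊞ A) biprod.inr ≫
        deriv (biprod.inl : A ⊞ A ⟶ (A ⊞ A) ⊞ (A ⊞ A)) biprod.inr := by
  rw [deriv_comp_map]
  apply deriv_comp_deriv_comm
  all_goals
    apply biprod.hom_ext
    all_goals
      apply biprod.hom_ext
      all_goals simp

variable (P) in
/-- The differential combinator transformation of the monad associated to an operad. -/
noncomputable def differential :
    DifferentialCombinatorTransformation P.associatedMonad.toMonad where
  app A := deriv (biprod.inl : A ⟶ A ⊞ A) biprod.inr
  naturality f := (map_comp_deriv _ _ _).trans (Eq.trans (by simp) (deriv_comp_map _ _ _).symm)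
  dc1 A := (deriv_comp_map _ _ _).trans (by rw [biprod.inr_fst, deriv_zero]; rfl)
  dc2 A := by
    refine (deriv_comp_map _ _ _).trans (Eq.trans ?_
      (congrArg₂ (· + ·) (deriv_comp_map _ _ _) (deriv_comp_map _ _ _)).symm)
    -- All three maps restrict to `inl` along `inl`; along `inr` the first is the sum of the other
    -- two, so additivity in the direction applies.
    have h₁ : ∀ y : A ⊞ A ⟶ A ⊞ A, (biprod.inl : A ⟶ A ⊞ A) ≫ y = 0 →
        (biprod.inl : A ⟶ A ⊞ A) ≫ biprod.lift biprod.fst y = biprod.inl := by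
      intro y hy
      apply biprod.hom_ext <;> simp [hy]
    have h₂ : ∀ y y' : A ⊞ A ⟶ A, (biprod.inl : A ⟶ A ⊞ A) ≫ y = 0 →
        (biprod.inl : A ⟶ A ⊞ A) ≫ y' = 0 →
        (biprod.inl : A ⟶ A ⊞ A) ≫ biprod.lift y y' = 0 := by
      intro y y' hy hy'
      apply biprod.hom_ext <;> simp [hy, hy']
    have h₃ : (biprod.inr : A ⟶ A ⊞ A) ≫
        biprod.lift biprod.fst (biprod.lift biprod.snd biprod.snd)
          = biprod.inr ≫ biprod.lift biprod.fst (biprod.lift biprod.snd 0)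
            + biprod.inr ≫ biprod.lift biprod.fst (biprod.lift 0 biprod.snd) := by
      apply biprod.hom_ext
      · simp
      · apply biprod.hom_ext <;> simp
    rw [h₁ _ (h₂ _ _ (by simp) (by simp)), h₁ _ (h₂ _ _ (by simp) (by simp)),
      h₁ _ (h₂ _ _ (by simp) (by simp)), h₃, deriv_add]
  dc3 A := by
    have h : (biprod.inr : A ⟶ A ⊞ A) = biprod.lift 0 (𝟙 A) := by
      apply biprod.hom_ext <;> simp
    refine (unit_comp_deriv _ _).trans ?_
    rw [h]
    rfl
  dc4 A := mul_comp_deriv_inl_inr A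
  dc5 A := by
    -- With the projection absorbed into the outer derivative, its direction vanishes on `inl`, as
    -- the diagonal rule requires.
    refine (congrArg (deriv _ _ ≫ ·) (deriv_comp_map _ _ _)).trans ?_
    refine (deriv_comp_deriv_diag (P := P) (biprod.inl : A ⟶ A ⊞ A) biprod.inr _ _ ?_).trans ?_
    · apply biprod.hom_ext <;> simp
    · have h₁ : (biprod.inl : A ⟶ A ⊞ A) ≫ biprod.inl ≫
          (biprod.lift (biprod.fst ≫ biprod.fst) (biprod.snd ≫ biprod.snd) :
            (A ⊞ A) ⊞ (A ⊞ A) ⟶ A ⊞ A) = biprod.inl := by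
        apply biprod.hom_ext <;> simp
      have h₂ : (biprod.inr : A ⟶ A ⊞ A) ≫ biprod.inr ≫
          (biprod.lift (biprod.fst ≫ biprod.fst) (biprod.snd ≫ biprod.snd) :
            (A ⊞ A) ⊞ (A ⊞ A) ⟶ A ⊞ A) = biprod.inr := by
        apply biprod.hom_ext <;> simp
      rw [h₁, h₂]
  dc6 A := deriv_comp_deriv_inl_inr A

end Differential

section

variable {R : Type u} [CommRing R] {P : Operad R}

theorem differential_app (V : ModuleCat.{u} R) {n : ℕ} (μ : P.obj n) (v : Fin n → V) :
    (P.differential.app V).hom (P.elt μ v) =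
      ∑ i : Fin n, P.elt μ (Function.update (fun j => (biprod.inl : V ⟶ V ⊞ V).hom (v j)) i
        ((biprod.inr : V ⟶ V ⊞ V).hom (v i))) := by
  refine (dirDeriv_elt _ _ μ v).trans (Finset.sum_congr rfl fun i _ => ?_)
  congr 1
  funext j
  by_cases hj : j = i
  · subst hj
    simp
  · simp [hj]

end

end Operad

/-! ### From coCartesian differential monads to Cartesian differential categories -/

namespace DifferentialCombinatorTransformation

section

open CartesianMonoidalCategory KleisliOp
open scoped MonoidalCategory

variable {C : Type v} [Category.{w} C] [Preadditive C] [HasBinaryBiproducts C]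
  {S : Monad C} (d : DifferentialCombinatorTransformation S)

/-- This is dc2 followed by S of the copairing of `x`, `y` and `z`. -/
theorem app_map_desc_add {A B : C} (x y z : A ⟶ B) :
    d.app A ≫ S.map (biprod.desc x (y + z))
      = d.app A ≫ S.map (biprod.desc x y) + d.app A ≫ S.map (biprod.desc x z) := by
  have h := congrArg (· ≫ S.map (biprod.desc x (biprod.desc y z))) (d.dc2 A)
  simp only [Preadditive.add_comp, Category.assoc, ← S.map_comp] at h
  convert h using 3
  · ext1 <;> simp
  · congr 2
    ext1 <;> simp
  · congr 2
    ext1 <;> simp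

theorem app_map_desc_zero {A B : C} (x : A ⟶ B) : d.app A ≫ S.map (biprod.desc x 0) = 0 := by
  have h : biprod.desc x (0 : A ⟶ B) = biprod.fst ≫ x := by ext1 <;> simp
  rw [h, S.map_comp, reassoc_of% d.dc1 A, zero_comp]

theorem unit_comp_app {A B : C} (x : A ⟶ B) :
    (x ≫ S.η.app B) ≫ d.app B = x ≫ biprod.inr ≫ S.η.app (B ⊞ B) := by
  have h : (biprod.inr : B ⟶ B ⊞ B) = biprod.lift 0 (𝟙 B) := by ext1 <;> simp
  rw [Category.assoc, d.dc3, h]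

/-- The chain rule for Kleisli composition: naturality moves ∂ past `S.map f`, after dc4 has moved
it past the multiplication. -/
theorem extend_comp_app {A B D : C} (f : B ⟶ S.obj A) (g : D ⟶ S.obj B) :
    (g ≫ S.map f ≫ S.μ.app A) ≫ d.app A
      = g ≫ (d.app B ≫ S.map (biprod.desc (f ≫ S.map biprod.inl) (f ≫ d.app A))) ≫
        S.μ.app (A ⊞ A) := by
  have h₁ : (biprod.lift (𝟙 A) 0 : A ⟶ A ⊞ A) = biprod.inl := by ext1 <;> simp
  have h₂ : biprod.desc (f ≫ S.map (biprod.inl : A ⟶ A ⊞ A)) (f ≫ d.app A)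
      = biprod.map f f ≫ (biprod.fst ≫ S.map biprod.inl + biprod.snd ≫ d.app A) := by
    ext1 <;> simp
  have h₃ := d.dc4 A
  rw [h₁] at h₃
  have h₄ := d.naturality f
  simp only [Category.assoc]
  rw [h₃, h₂, S.map_comp, reassoc_of% h₄, Category.assoc]

variable [HasZeroObject C]

theorem homEquiv_comp_fst_comp {A B : (Kleisli S)ᵒᵖ} (f : A ⟶ B) :
    homEquiv S (A ⊗ A) B (fst A A ≫ f)
      = homEquiv S A B f ≫ S.map (biprod.inl : A.unop.of ⟶ A.unop.of ⊞ A.unop.of) := by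
  change homEquiv S A B f ≫ S.map ((biprod.inl : A.unop.of ⟶ A.unop.of ⊞ A.unop.of) ≫
    S.η.app (A.unop.of ⊞ A.unop.of)) ≫ S.μ.app (A.unop.of ⊞ A.unop.of) = _
  simp

/-- The differential combinator `D[f] = f ≫ ∂`. -/
noncomputable def combinator {A B : (Kleisli S)ᵒᵖ} (f : A ⟶ B) : A ⊗ A ⟶ B :=
  (homEquiv S (A ⊗ A) B).symm (homEquiv S A B f ≫ d.app A.unop.of)

theorem homEquiv_combinator {A B : (Kleisli S)ᵒᵖ} (f : A ⟶ B) :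
    homEquiv S (A ⊗ A) B (d.combinator f) = homEquiv S A B f ≫ d.app A.unop.of := rfl

theorem homEquiv_lift_comp_combinator {A B Z : (Kleisli S)ᵒᵖ} (f : A ⟶ B) (x y : Z ⟶ A) :
    homEquiv S Z B (lift x y ≫ d.combinator f)
      = homEquiv S A B f ≫ (d.app A.unop.of ≫
        S.map (biprod.desc (homEquiv S Z A x) (homEquiv S Z A y))) ≫ S.μ.app Z.unop.of := by
  change (homEquiv S A B f ≫ d.app A.unop.of) ≫ S.map (biprod.desc (homEquiv S Z A x)
    (homEquiv S Z A y)) ≫ S.μ.app Z.unop.of = _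
  simp only [Category.assoc]

theorem homEquiv_lift_comp_combinator_combinator {A B Z : (Kleisli S)ᵒᵖ} (f : A ⟶ B)
    (x y z t : Z ⟶ A) :
    homEquiv S Z B (lift (lift x y) (lift z t) ≫ d.combinator (d.combinator f))
      = homEquiv S A B f ≫ (d.app A.unop.of ≫ d.app (A.unop.of ⊞ A.unop.of) ≫
        S.map (biprod.desc (biprod.desc (homEquiv S Z A x) (homEquiv S Z A y))
          (biprod.desc (homEquiv S Z A z) (homEquiv S Z A t)))) ≫ S.μ.app Z.unop.of := by
  change ((homEquiv S A B f ≫ d.app A.unop.of) ≫ d.app (A.unop.of ⊞ A.unop.of)) ≫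
    S.map (biprod.desc (biprod.desc (homEquiv S Z A x) (homEquiv S Z A y))
      (biprod.desc (homEquiv S Z A z) (homEquiv S Z A t))) ≫ S.μ.app Z.unop.of = _
  simp only [Category.assoc]

/-- The opposite of the Kleisli category of a coCartesian differential monad is a Cartesian
differential category. -/
noncomputable def cartesianDifferentialCategory : CartesianDifferentialCategory (Kleisli S)ᵒᵖ where
  D f := d.combinator f
  cd1_add f g := (homEquiv S _ _).injective (Preadditive.add_comp _ _ _ _ _ _)
  cd1_zero := (homEquiv S _ _).injective zero_comp
  cd2_add f x y z := (homEquiv S _ _).injective (by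
    rw [homEquiv_add, homEquiv_lift_comp_combinator, homEquiv_lift_comp_combinator,
      homEquiv_lift_comp_combinator, homEquiv_add, app_map_desc_add, Preadditive.add_comp,
      Preadditive.comp_add])
  cd2_zero f x := (homEquiv S _ _).injective (by
    rw [homEquiv_lift_comp_combinator, homEquiv_zero, homEquiv_zero, app_map_desc_zero, zero_comp,
      comp_zero])
  cd3_id A := (homEquiv S _ _).injective (by
    refine (d.dc3 A.unop.of).trans ?_
    rw [homEquiv_snd]
    congr 1
    ext1 <;> simp)
  cd3_fst A B := (homEquiv S _ _).injective (by
    rw [homEquiv_comp_fst, homEquiv_snd]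
    exact d.unit_comp_app biprod.inl)
  cd3_snd A B := (homEquiv S _ _).injective (by
    rw [homEquiv_comp_snd, homEquiv_snd]
    exact d.unit_comp_app biprod.inr)
  cd4 {A B D} f g := (homEquiv S _ _).injective (by
    change biprod.desc (homEquiv S A B f) (homEquiv S A D g) ≫ d.app A.unop.of
      = biprod.desc (homEquiv S A B f ≫ d.app A.unop.of) (homEquiv S A D g ≫ d.app A.unop.of)
    ext1 <;> simp)
  cd5 {A B D} f g := (homEquiv S _ _).injective (by
    rw [homEquiv_lift_comp_combinator, homEquiv_comp_fst_comp]
    exact d.extend_comp_app (homEquiv S A B f) (homEquiv S B D g))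
  cd6 {A B Z} f x y := (homEquiv S _ _).injective (by
    rw [homEquiv_lift_comp_combinator_combinator, homEquiv_lift_comp_combinator, homEquiv_zero]
    congr 2
    -- The zeros make this copairing factor through the projection onto the outer two factors, the
    -- one occurring in dc5.
    have h : biprod.desc (biprod.desc (homEquiv S Z A x) (0 : A.unop.of ⟶ _))
          (biprod.desc (0 : A.unop.of ⟶ _) (homEquiv S Z A y))
        = biprod.lift (biprod.fst ≫ biprod.fst) (biprod.snd ≫ biprod.snd) ≫
          biprod.desc (homEquiv S Z A x) (homEquiv S Z A y) := by
      ext1 <;> ext1 <;> simp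
    rw [h, S.map_comp, ← Category.assoc (d.app _), ← Category.assoc, Category.assoc (d.app _),
      d.dc5])
  cd7 {A B Z} f x y z t := (homEquiv S _ _).injective (by
    rw [homEquiv_lift_comp_combinator_combinator, homEquiv_lift_comp_combinator_combinator]
    congr 2
    -- Swapping `y` and `z` amounts to precomposing with the interchange of dc6.
    have h : biprod.desc (biprod.desc (homEquiv S Z A x) (homEquiv S Z A y))
          (biprod.desc (homEquiv S Z A z) (homEquiv S Z A t))
        = biprod.lift (biprod.lift (biprod.fst ≫ biprod.fst) (biprod.snd ≫ biprod.fst))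
            (biprod.lift (biprod.fst ≫ biprod.snd) (biprod.snd ≫ biprod.snd)) ≫
          biprod.desc (biprod.desc (homEquiv S Z A x) (homEquiv S Z A z))
            (biprod.desc (homEquiv S Z A y) (homEquiv S Z A t)) := by
      ext1 <;> ext1 <;> simp
    rw [h, S.map_comp]
    have := congrArg (· ≫ S.map (biprod.desc (biprod.desc (homEquiv S Z A x) (homEquiv S Z A z))
      (biprod.desc (homEquiv S Z A y) (homEquiv S Z A t)))) (d.dc6 A.unop.of)
    simpa only [Category.assoc] using this)

end

end DifferentialCombinatorTransformation

theorem mainTheorem4 {R : Type u} [CommRing R] (P : Operad.{u} R) :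
    ∃ (M : P.AssociatedMonad) (d : DifferentialCombinatorTransformation M.toMonad),
      (∀ (V : ModuleCat.{u} R) (n : ℕ) (μ : P.obj n) (v : Fin n → V),
        (d.app V).hom (P.elt μ v) =
          ∑ i : Fin n, P.elt μ (Function.update (fun j => (biprod.inl : V ⟶ V ⊞ V).hom (v j)) i
            ((biprod.inr : V ⟶ V ⊞ V).hom (v i)))) ∧
      ∃ K : CartesianDifferentialCategory (Kleisli M.toMonad)ᵒᵖ,
        ∀ (A B : (Kleisli M.toMonad)ᵒᵖ) (f : A ⟶ B),
          KleisliOp.homEquiv M.toMonad _ _ (K.D f) =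
            KleisliOp.homEquiv M.toMonad A B f ≫ d.app A.unop.of :=
  ⟨P.associatedMonad, P.differential, fun V _ μ v => Operad.differential_app V μ v,
    P.differential.cartesianDifferentialCategory, fun _ _ f =>
      P.differential.homEquiv_combinator f⟩
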